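/- Let $n\ge 1$. A cube in $\mathbb R^n$ means a cube with sides parallel to the coordinate axes (open, closed or half-open), $l(Q)$ is its sidelength, and $|\cdot|$ is Lebesgue measure. For a measurable set $A\subset\mathbb R^n$ and a cube $Q$ let $D(Q)=|A\cap Q|/|Q|$. Two cubes $Q,Q'$ with $l(Q)=l(Q')$ are consecutive if the intersection of their closures is one of their ($(n-1)$-dimensional) faces. The measurable set $A$ is called smooth if $$\lim_{\delta\to0}\ \sup |D(Q)-D(Q')|=0,$$ where the supremum is taken over all pairs of consecutive cubes $Q,Q'$ with $l(Q)=l(Q')\le\delta$. Let $Q(x,h)$ denote the cube centered at $x$ of sidelength $h>0$. Theorem. Let $A\subset\mathbb R^n$ be a smooth set with $|A|>0$ and $|\mathbb R^n\setminus A|>0$, and let $0<\alpha<1$. Then the set $$E(A,\alpha)=\Bigl\{x\in\mathbb R^n:\ \lim_{h\to0}D(Q(x,h))=\alpha\Bigr\}$$ has Hausdorff dimension $n$. Moreover, for every cube $Q\subset\mathbb R^n$ with $0<|A\cap Q|<|Q|$, both $E(A,\alpha)\cap Q$ and $\partial A\cap Q$ have Hausdorff dimension $n$, where $\partial A$ is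 the topological boundary of $A$. -/

import Mathlib

open MeasureTheory Filter Topology

noncomputable section

namespace SmoothSet

/-- The closed axis-parallel cube with lower corner `a` and sidelength `l`. -/
def closedCube {n : ℕ} (a : EuclideanSpace ℝ (Fin n)) (l : ℝ) :
    Set (EuclideanSpace ℝ (Fin n)) :=
  {x | ∀ i, a i ≤ x i ∧ x i ≤ a i + l}

/-- The set `Q` is an axis-parallel cube with lower corner `a` and sidelength `l > 0`: a product
of intervals with endpoints `a i` and `a i + l`. Each interval may or may not contain each of its
endpoints, so that open, half-open and closed cubes are all covered. -/
def IsCubeAt {n : ℕ} (a : EuclideanSpace ℝ (Fin n)) (l : ℝ)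
    (Q : Set (EuclideanSpace ℝ (Fin n))) : Prop :=
  0 < l ∧ ∃ I : Fin n → Set ℝ,
    (∀ i, Set.Ioo (a i) (a i + l) ⊆ I i ∧ I i ⊆ Set.Icc (a i) (a i + l)) ∧
    Q = {x | ∀ i, x i ∈ I i}

/-- The set `Q` is an axis-parallel cube. -/
def IsCube {n : ℕ} (Q : Set (EuclideanSpace ℝ (Fin n))) : Prop :=
  ∃ (a : EuclideanSpace ℝ (Fin n)) (l : ℝ), IsCubeAt a l Q

/-- The set `F` is one of the `2 * n` faces (of dimension `n - 1`) of the closed cube with lower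
corner `a` and sidelength `l`. -/
def IsFace {n : ℕ} (a : EuclideanSpace ℝ (Fin n)) (l : ℝ)
    (F : Set (EuclideanSpace ℝ (Fin n))) : Prop :=
  ∃ i : Fin n, F = {x ∈ closedCube a l | x i = a i} ∨ F = {x ∈ closedCube a l | x i = a i + l}

/-- `Q` and `Q'` are consecutive cubes of the same sidelength `l`: the intersection of their
closures is a face of both. -/
def Consecutive {n : ℕ} (l : ℝ) (Q Q' : Set (EuclideanSpace ℝ (Fin n))) : Prop :=
  ∃ a a' : EuclideanSpace ℝ (Fin n), IsCubeAt a l Q ∧ IsCubeAt a' l Q' ∧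
    IsFace a l (closure Q ∩ closure Q') ∧ IsFace a' l (closure Q ∩ closure Q')

/-- The density `|A ∩ Q| / |Q|` of `A` in `Q`. -/
def density {n : ℕ} (A Q : Set (EuclideanSpace ℝ (Fin n))) : ℝ :=
  (volume (A ∩ Q)).toReal / (volume Q).toReal

/-- `A` is a smooth set: it is Lebesgue measurable, and the supremum of `|D(Q) - D(Q')|` over all
pairs of consecutive cubes of the same sidelength `l ≤ δ` tends to `0` as `δ → 0`. -/
def IsSmooth {n : ℕ} (A : Set (EuclideanSpace ℝ (Fin n))) : Prop :=
  NullMeasurableSet A volume ∧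
    ∀ ε : ℝ, 0 < ε → ∃ δ : ℝ, 0 < δ ∧
      ∀ (l : ℝ) (Q Q' : Set (EuclideanSpace ℝ (Fin n))), l ≤ δ → Consecutive l Q Q' →
        |density A Q - density A Q'| ≤ ε

/-- The closed cube `Q(x, h)` centered at `x` of sidelength `h`. -/
def centeredCube {n : ℕ} (x : EuclideanSpace ℝ (Fin n)) (h : ℝ) :
    Set (EuclideanSpace ℝ (Fin n)) :=
  {y | ∀ i, |y i - x i| ≤ h / 2}

/-- `E(A, α)`: the points `x` with `D(Q(x, h)) → α` as `h → 0`, `h > 0`. -/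
def densitySet {n : ℕ} (A : Set (EuclideanSpace ℝ (Fin n))) (α : ℝ) :
    Set (EuclideanSpace ℝ (Fin n)) :=
  {x | Tendsto (fun h : ℝ => density A (centeredCube x h)) (𝓝[>] 0) (𝓝 α)}

end SmoothSet

end

/-!
The densities `D(Q)` of `A` in dyadic cubes form a bounded martingale: each is the mean of the
densities of the `2 ^ n` halves of the cube. Smoothness says that adjacent dyadic cubes, hence also
a cube and its halves, have densities that differ by little at small scales, and by Lebesgue's
density theorem almost every path of the martingale tends to `0` or `1`.

Let `Q` be a small dyadic cube with `D(Q)` close to `α`. After a descent of `M` levels the density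
is still close to `α`. From there the martingale is run until it crosses `α` or leaves a slightly
larger interval around `α`. Almost every path stops, because `α` is neither `0` nor `1`, and
optional stopping shows that the paths that cross `α` fill at least a quarter of `Q`. As the
increments are small, the density of the cube at the crossing is again close to `α`, with a smaller
error (`exists_good_subcubes`). Iterating yields a Cantor set: each cube is replaced by finitely many
disjoint subcubes, at least `M` levels deeper, that cover a quarter of it, and all intermediate
cubes have densities near `α`. When `2 ^ ((n - d) * M) ≥ 4`, the natural mass distribution on the
Cantor set gives mass `O(r ^ d)` to balls of radius `r`, so the dimension is at least `d`
(`IsBranching.le_dimH_limitSet`). Since `d < n` is arbitrary, this gives dimension `n`.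

Three facts connect this to the statement. A point at which the dyadic densities tend to `α`
belongs to `densitySet A α`, since a centered cube is almost filled by much smaller dyadic cubes,
whose densities are all close (`tendsto_density_closedBall`). A cube in which `A` is neither null
nor of full measure contains small dyadic cubes with density near `1` and near `0`, hence by a
discrete intermediate value argument one with density near `α` (`le_dimH_inter_box`). Finally,
`densitySet A α` is contained in the boundary of `A`.

The construction takes place in `Fin n → ℝ`, whose supremum norm has cubes as balls, and is
transported to Euclidean space at the end.
-/

/-! ### Dyadic cubes -/

noncomputable section

namespace SmoothSet

variable {n : ℕ}

/-- The index of the dyadic cube of side `2 ^ (-j)` that contains the point `x`. -/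
def dyadicIndex (j : ℕ) (x : Fin n → ℝ) : Fin n → ℤ := fun i => ⌊x i * (2 : ℝ) ^ j⌋

/-- The half-open dyadic cube of side `2 ^ (-j)` with lower corner `2 ^ (-j) • v`, as a fibre of
`dyadicIndex j`. -/
def dyadicCube (j : ℕ) (v : Fin n → ℤ) : Set (Fin n → ℝ) := {x | dyadicIndex j x = v}

/-- The indices at level `j + 1` of the `2 ^ n` dyadic halves of the dyadic cube of index `v` at
level `j`. -/
def children (v : Fin n → ℤ) : Finset (Fin n → ℤ) :=
  Fintype.piFinset fun i => {2 * v i, 2 * v i + 1}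

lemma mem_dyadicCube {j : ℕ} {v : Fin n → ℤ} {x : Fin n → ℝ} :
    x ∈ dyadicCube j v ↔ dyadicIndex j x = v := Iff.rfl

lemma mem_dyadicCube_dyadicIndex (j : ℕ) (x : Fin n → ℝ) :
    x ∈ dyadicCube j (dyadicIndex j x) := rfl

lemma mem_dyadicCube_iff {j : ℕ} {v : Fin n → ℤ} {x : Fin n → ℝ} :
    x ∈ dyadicCube j v ↔ ∀ i, v i ≤ x i * (2 : ℝ) ^ j ∧ x i * (2 : ℝ) ^ j < v i + 1 := by
  simp only [mem_dyadicCube, dyadicIndex, funext_iff, Int.floor_eq_iff]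

lemma dyadicCube_eq_pi (j : ℕ) (v : Fin n → ℤ) :
    dyadicCube j v = Set.univ.pi fun i => Set.Ico (v i / (2 : ℝ) ^ j) ((v i + 1) / (2 : ℝ) ^ j) := by
  ext x
  simp only [mem_dyadicCube_iff, Set.mem_univ_pi, Set.mem_Ico,
    div_le_iff₀ (pow_pos (two_pos (α := ℝ)) j), lt_div_iff₀ (pow_pos (two_pos (α := ℝ)) j)]

lemma measurableSet_dyadicCube (j : ℕ) (v : Fin n → ℤ) : MeasurableSet (dyadicCube j v) := by
  rw [dyadicCube_eq_pi]
  exact MeasurableSet.univ_pi fun i => measurableSet_Ico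

lemma measurable_dyadicIndex (j : ℕ) : Measurable (dyadicIndex (n := n) j) := by
  refine measurable_pi_lambda _ fun i => ?_
  exact Int.measurable_floor.comp ((measurable_pi_apply i).mul_const _)

lemma dyadicCube_nonempty (j : ℕ) (v : Fin n → ℤ) : (dyadicCube j v).Nonempty := by
  refine ⟨fun i => v i / (2 : ℝ) ^ j, mem_dyadicCube_iff.2 fun i => ?_⟩
  rw [div_mul_cancel₀ _ (by positivity)]
  exact ⟨le_rfl, by linarith⟩

lemma volume_dyadicCube (j : ℕ) (v : Fin n → ℤ) :
    volume (dyadicCube j v) = ENNReal.ofReal (((2 : ℝ) ^ (n * j))⁻¹) := by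
  rw [dyadicCube_eq_pi, Real.volume_pi_Ico, ← ENNReal.ofReal_prod_of_nonneg]
  · congr 1
    have (i : Fin n) : ((v i : ℝ) + 1) / 2 ^ j - v i / 2 ^ j = ((2 : ℝ) ^ j)⁻¹ := by ring
    simp [this, pow_mul']
  · intro i _
    rw [← sub_div, add_sub_cancel_left]
    positivity

lemma volume_dyadicCube_ne_top (j : ℕ) (v : Fin n → ℤ) : volume (dyadicCube j v) ≠ ⊤ := by
  simp [volume_dyadicCube]

lemma volume_real_dyadicCube (j : ℕ) (v : Fin n → ℤ) :
    volume.real (dyadicCube j v) = ((2 : ℝ) ^ (n * j))⁻¹ := by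
  rw [measureReal_def, volume_dyadicCube, ENNReal.toReal_ofReal (by positivity)]

lemma volume_real_dyadicCube_pos (j : ℕ) (v : Fin n → ℤ) : 0 < volume.real (dyadicCube j v) := by
  rw [volume_real_dyadicCube]
  positivity

/-- The dyadic partitions refine each other. -/
lemma dyadicIndex_eq_of_le {j k : ℕ} (hjk : j ≤ k) {x y : Fin n → ℝ}
    (h : dyadicIndex k x = dyadicIndex k y) : dyadicIndex j x = dyadicIndex j y := by
  have key (z : Fin n → ℝ) (i : Fin n) :
      dyadicIndex j z i = dyadicIndex k z i / ((2 ^ (k - j) : ℕ) : ℤ) := by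
    have : z i * (2 : ℝ) ^ j = z i * 2 ^ k / ((2 ^ (k - j) : ℕ) : ℝ) := by
      rw [eq_div_iff (by positivity)]
      push_cast
      rw [mul_assoc, ← pow_add, Nat.add_sub_cancel' hjk]
    simp only [dyadicIndex]
    rw [this, Int.floor_div_natCast]
  ext i
  rw [key, key, h]

lemma dyadicCube_subset_of_mem {j k : ℕ} (hjk : j ≤ k) {u v : Fin n → ℤ} {x : Fin n → ℝ}
    (hu : x ∈ dyadicCube k u) (hv : x ∈ dyadicCube j v) : dyadicCube k u ⊆ dyadicCube j v := by
  intro y hy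
  rw [mem_dyadicCube] at *
  rw [← hv]
  exact dyadicIndex_eq_of_le hjk (hy.trans hu.symm)

lemma disjoint_dyadicCube {j : ℕ} {u v : Fin n → ℤ} (h : u ≠ v) :
    Disjoint (dyadicCube j u) (dyadicCube j v) :=
  Set.disjoint_left.2 fun _ hu hv => h (hu.symm.trans hv)

lemma card_children (v : Fin n → ℤ) : (children v).card = 2 ^ n := by
  rw [children, Fintype.card_piFinset, Finset.prod_congr rfl fun i _ => Finset.card_pair (by simp)]
  simp

lemma dyadicIndex_succ_mem_children (j : ℕ) (x : Fin n → ℝ) :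
    dyadicIndex (j + 1) x ∈ children (dyadicIndex j x) := by
  refine Fintype.mem_piFinset.2 fun i => ?_
  have h1 := Int.floor_le (x i * (2 : ℝ) ^ j)
  have h2 := Int.lt_floor_add_one (x i * (2 : ℝ) ^ j)
  simp only [dyadicIndex, Finset.mem_insert, Finset.mem_singleton, Int.floor_eq_iff, pow_succ]
  push_cast
  rcases lt_or_ge (x i * (2 : ℝ) ^ j) (⌊x i * (2 : ℝ) ^ j⌋ + 1 / 2) with h | h
  · left
    constructor <;> linarith
  · right
    constructor <;> linarith

lemma dyadicCube_child_subset (j : ℕ) {u v : Fin n → ℤ} (hu : u ∈ children v) :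
    dyadicCube (j + 1) u ⊆ dyadicCube j v := by
  intro x hx
  rw [mem_dyadicCube_iff] at *
  intro i
  have h := Fintype.mem_piFinset.1 hu i
  have hx := hx i
  simp only [Finset.mem_insert, Finset.mem_singleton] at h
  rw [pow_succ] at hx
  have h' : (u i : ℝ) = 2 * v i ∨ (u i : ℝ) = 2 * v i + 1 := by exact_mod_cast h
  rcases h' with h | h <;> rw [h] at hx <;> constructor <;> linarith

lemma volume_real_child (j : ℕ) (u v : Fin n → ℤ) :
    (2 : ℝ) ^ n * volume.real (dyadicCube (j + 1) u) = volume.real (dyadicCube j v) := by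
  rw [volume_real_dyadicCube, volume_real_dyadicCube, mul_add, pow_add, mul_one]
  field_simp

/-- The measure of a set inside a dyadic cube is the sum over the children. -/
lemma sum_children_volume_real (E : Set (Fin n → ℝ)) (j : ℕ) (v : Fin n → ℤ) :
    ∑ u ∈ children v, volume.real (E ∩ dyadicCube (j + 1) u) = volume.real (E ∩ dyadicCube j v) := by
  have h (k : ℕ) (w : Fin n → ℤ) : volume.real (E ∩ dyadicCube k w)
      = (volume.restrict E).real (dyadicCube k w) := by
    rw [measureReal_restrict_apply (measurableSet_dyadicCube k w), Set.inter_comm]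
  simp only [h]
  rw [← measureReal_biUnion_finset (h := ?_)]
  · congr 1
    ext x
    simp only [Set.mem_iUnion, exists_prop]
    constructor
    · rintro ⟨u, hu, hx⟩
      exact dyadicCube_child_subset j hu hx
    · intro hx
      rw [mem_dyadicCube] at hx
      exact ⟨_, hx ▸ dyadicIndex_succ_mem_children j x, rfl⟩
  · intro u _ w _ huw
    exact disjoint_dyadicCube huw
  · intro u _
    exact measurableSet_dyadicCube _ _
  · intro u _
    rw [Measure.restrict_apply (measurableSet_dyadicCube _ _)]
    exact ne_top_of_le_ne_top (volume_dyadicCube_ne_top (j + 1) u)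
      (measure_mono Set.inter_subset_left)

lemma closure_dyadicCube_subset (j : ℕ) (v : Fin n → ℤ) :
    closure (dyadicCube j v) ⊆
      Set.Icc (fun i => v i / (2 : ℝ) ^ j) (fun i => (v i + 1) / (2 : ℝ) ^ j) := by
  refine closure_minimal ?_ isClosed_Icc
  rw [dyadicCube_eq_pi, ← Set.pi_univ_Icc]
  exact Set.pi_mono fun i _ => Set.Ico_subset_Icc_self

lemma isCompact_closure_dyadicCube (j : ℕ) (v : Fin n → ℤ) :
    IsCompact (closure (dyadicCube j v)) :=
  isCompact_Icc.of_isClosed_subset isClosed_closure (closure_dyadicCube_subset j v)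

/-- Points of the closure of a dyadic cube have indices adjacent to those of the cube, also at all
coarser levels. -/
lemma abs_dyadicIndex_sub_le {j k : ℕ} (hjk : j ≤ k) {v : Fin n → ℤ} {x y : Fin n → ℝ}
    (hx : x ∈ closure (dyadicCube k v)) (hy : y ∈ closure (dyadicCube k v)) (i : Fin n) :
    |dyadicIndex j x i - dyadicIndex j y i| ≤ 1 := by
  have hx' := closure_dyadicCube_subset k v hx
  have hy' := closure_dyadicCube_subset k v hy
  have h1 := hx'.1 i
  have h2 := hx'.2 i
  have h3 := hy'.1 i
  have h4 := hy'.2 i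
  simp only at h1 h2 h3 h4
  have hd : |x i - y i| * (2 : ℝ) ^ j ≤ 1 := by
    calc |x i - y i| * (2 : ℝ) ^ j ≤ (1 / 2 ^ k) * 2 ^ k := by
          gcongr
          · rw [add_div] at h2 h4
            rw [abs_le]
            constructor <;> linarith
          · norm_num
      _ = 1 := by field_simp
  rw [← abs_of_pos (pow_pos (two_pos (α := ℝ)) j), ← abs_mul, sub_mul, abs_le] at hd
  have e1 : dyadicIndex j x i ≤ dyadicIndex j y i + 1 := by
    simp only [dyadicIndex]
    rw [← Int.floor_add_one]
    exact Int.floor_le_floor (by linarith)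
  have e2 : dyadicIndex j y i ≤ dyadicIndex j x i + 1 := by
    simp only [dyadicIndex]
    rw [← Int.floor_add_one]
    exact Int.floor_le_floor (by linarith)
  rw [abs_le]
  constructor <;> linarith

/-! ### Stopping-time families of dyadic cubes -/

/-- A family of real numbers indexed by dyadic cubes is a dyadic martingale if its value at each
cube is the mean of the values at the `2 ^ n` children. -/
def IsDyadicMartingale (X : ℕ → (Fin n → ℤ) → ℝ) : Prop :=
  ∀ j v, ∑ u ∈ children v, X (j + 1) u = 2 ^ n * X j v

/-- The points whose dyadic cubes at the levels `m, …, m + t` all have values of `X` in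
`(0, β)`. -/
def survivors (X : ℕ → (Fin n → ℤ) → ℝ) (β : ℝ) (t m : ℕ) : Set (Fin n → ℝ) :=
  {x | ∀ j, m ≤ j → j ≤ m + t → X j (dyadicIndex j x) ∈ Set.Ioo 0 β}

/-- Families of disjoint subcubes of the children of a cube unite to a family of disjoint
cubes. -/
lemma pairwiseDisjoint_biUnion_children {S : (Fin n → ℤ) → Finset (ℕ × (Fin n → ℤ))} {m : ℕ}
    {v : Fin n → ℤ}
    (hsub : ∀ u ∈ children v, ∀ q ∈ S u, dyadicCube q.1 q.2 ⊆ dyadicCube (m + 1) u)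
    (hdisj : ∀ u ∈ children v, (S u : Set (ℕ × (Fin n → ℤ))).PairwiseDisjoint
      fun q => dyadicCube q.1 q.2) :
    (((children v).biUnion S : Finset _) : Set (ℕ × (Fin n → ℤ))).PairwiseDisjoint
      fun q => dyadicCube q.1 q.2 := by
  intro q hq r hr hqr
  simp only [Finset.coe_biUnion, Set.mem_iUnion, Finset.mem_coe, exists_prop] at hq hr
  obtain ⟨u, hu, hq⟩ := hq
  obtain ⟨w, hw, hr⟩ := hr
  by_cases huw : u = w
  · subst huw
    exact hdisj u hu hq hr hqr
  · exact (disjoint_dyadicCube huw).mono (hsub u hu q hq) (hsub w hw r hr)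

lemma sum_biUnion_children {S : (Fin n → ℤ) → Finset (ℕ × (Fin n → ℤ))} {m : ℕ} {v : Fin n → ℤ}
    (hsub : ∀ u ∈ children v, ∀ q ∈ S u, dyadicCube q.1 q.2 ⊆ dyadicCube (m + 1) u)
    (f : ℕ × (Fin n → ℤ) → ℝ) :
    ∑ q ∈ (children v).biUnion S, f q = ∑ u ∈ children v, ∑ q ∈ S u, f q := by
  refine Finset.sum_biUnion fun u hu w hw huw => Finset.disjoint_left.2 fun q hq hq' => ?_
  obtain ⟨x, hx⟩ := dyadicCube_nonempty q.1 q.2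
  exact (Set.disjoint_left.1 (disjoint_dyadicCube huw) (hsub u hu q hq hx)) (hsub w hw q hq' hx)

/-- Optional stopping: the cubes at which the martingale first becomes nonpositive within `t`
steps, before reaching `β`. The inequality compares the integral of `X` over the cube with that
of the stopped martingale, which is at least `β` where `β` was reached, at least `-W` on the
selected cubes and positive on the survivors. -/
lemma exists_stopping_family {X : ℕ → (Fin n → ℤ) → ℝ} {ω : ℕ → ℝ} (hω : Antitone ω)
    (hX : IsDyadicMartingale X)
    (hjump : ∀ j v, ∀ u ∈ children v, |X (j + 1) u - X j v| ≤ ω (j + 1)) {β W : ℝ} (hβ : 0 ≤ β)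
    (t m : ℕ) (v : Fin n → ℤ) (hW : ω m ≤ W) (hv : -ω m ≤ X m v) :
    ∃ S : Finset (ℕ × (Fin n → ℤ)),
      (∀ q ∈ S, m ≤ q.1 ∧ dyadicCube q.1 q.2 ⊆ dyadicCube m v ∧ |X q.1 q.2| ≤ ω q.1 ∧
        ∀ x ∈ dyadicCube q.1 q.2, ∀ j, m ≤ j → j < q.1 →
          X j (dyadicIndex j x) ∈ Set.Ioo 0 β) ∧
      (S : Set (ℕ × (Fin n → ℤ))).PairwiseDisjoint (fun q => dyadicCube q.1 q.2) ∧
      β * (volume.real (dyadicCube m v) - ∑ q ∈ S, volume.real (dyadicCube q.1 q.2)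
          - volume.real (survivors X β t m ∩ dyadicCube m v))
        - W * ∑ q ∈ S, volume.real (dyadicCube q.1 q.2)
        ≤ X m v * volume.real (dyadicCube m v) := by
  induction t using Nat.strong_induction_on generalizing m v with | _ t ih => ?_
  have hpos := volume_real_dyadicCube_pos m v
  have hU : 0 ≤ volume.real (survivors X β t m ∩ dyadicCube m v) := measureReal_nonneg
  by_cases h0 : X m v ≤ 0
  · refine ⟨{(m, v)}, ?_, by simp, ?_⟩
    · simp only [Finset.mem_singleton, forall_eq, le_refl, true_and]
      refine ⟨abs_le.2 ⟨hv, h0.trans ?_⟩, fun x _ j h1 h2 => absurd h1 (not_le.2 h2)⟩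
      linarith
    · simp only [Finset.sum_singleton]
      nlinarith [mul_nonneg hβ hU]
  by_cases h1 : β ≤ X m v
  · refine ⟨∅, by simp, by simp, ?_⟩
    simp only [Finset.sum_empty]
    nlinarith [mul_nonneg hβ hU]
  push Not at h0 h1
  rcases t with _ | t
  · refine ⟨∅, by simp, by simp, ?_⟩
    have : survivors X β 0 m ∩ dyadicCube m v = dyadicCube m v := by
      refine Set.inter_eq_right.2 fun x hx j hj hj' => ?_
      obtain rfl : j = m := by omega
      rw [mem_dyadicCube.1 hx]
      exact ⟨h0, h1⟩
    rw [this]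
    simp only [Finset.sum_empty]
    nlinarith
  · have step := fun u (hu : u ∈ children v) => ih t (Nat.lt_succ_self t) (m + 1) u
      ((hω (Nat.le_succ m)).trans hW) (by linarith [abs_le.1 (hjump m v u hu)])
    choose! S hS hdisj hineq using step
    refine ⟨(children v).biUnion S, ?_, pairwiseDisjoint_biUnion_children
      (fun u hu q hq => (hS u hu q hq).2.1) hdisj, ?_⟩
    · intro q hq
      obtain ⟨u, hu, hq⟩ := Finset.mem_biUnion.1 hq
      obtain ⟨a1, a2, a3, a4⟩ := hS u hu q hq
      refine ⟨by omega, a2.trans (dyadicCube_child_subset m hu), a3, fun x hx j hj hj' => ?_⟩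
      rcases hj.eq_or_lt with rfl | hj
      · rw [mem_dyadicCube.1 (dyadicCube_child_subset m hu (a2 hx))]
        exact ⟨h0, h1⟩
      · exact a4 x hx j hj hj'
    · rw [sum_biUnion_children (fun u hu q hq => (hS u hu q hq).2.1)]
      have hsum := Finset.sum_le_sum hineq
      have e1 : ∑ u ∈ children v, X (m + 1) u * volume.real (dyadicCube (m + 1) u)
          = X m v * volume.real (dyadicCube m v) := by
        have h2 : (2 : ℝ) ^ n ≠ 0 := by positivity
        have (u : Fin n → ℤ) : volume.real (dyadicCube (m + 1) u)
            = volume.real (dyadicCube m v) / 2 ^ n := by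
          rw [← volume_real_child m u v]
          field_simp
        simp only [this]
        rw [← Finset.sum_mul, hX m v]
        field_simp
      have e2 : ∑ u ∈ children v, volume.real (dyadicCube (m + 1) u)
          = volume.real (dyadicCube m v) := by
        simpa using sum_children_volume_real Set.univ m v
      have e3 : ∑ u ∈ children v,
          volume.real (survivors X β t (m + 1) ∩ dyadicCube (m + 1) u)
          = volume.real (survivors X β (t + 1) m ∩ dyadicCube m v) := by
        rw [← sum_children_volume_real]
        refine Finset.sum_congr rfl fun u hu => ?_
        congr 1
        ext x
        simp only [survivors, Set.mem_inter_iff, Set.mem_ofPred_eq, and_congr_left_iff]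
        intro hx
        constructor
        · intro h j hj hj'
          rcases hj.eq_or_lt with rfl | hj
          · rw [mem_dyadicCube.1 (dyadicCube_child_subset m hu hx)]
            exact ⟨h0, h1⟩
          · exact h j hj (by omega)
        · intro h j hj hj'
          exact h j (by omega) (by omega)
      rw [e1] at hsum
      refine le_trans (le_of_eq ?_) hsum
      rw [← e2, ← e3]
      simp only [Finset.mul_sum, ← Finset.sum_sub_distrib]

lemma measurableSet_survivors (X : ℕ → (Fin n → ℤ) → ℝ) (β : ℝ) (t m : ℕ) :
    MeasurableSet (survivors X β t m) := by
  have : survivors X β t m = ⋂ j, ⋂ (_ : m ≤ j), ⋂ (_ : j ≤ m + t),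
      (dyadicIndex j) ⁻¹' {v | X j v ∈ Set.Ioo 0 β} := by
    ext x
    simp [survivors]
  rw [this]
  exact MeasurableSet.iInter fun j => MeasurableSet.iInter fun _ => MeasurableSet.iInter fun _ =>
    measurable_dyadicIndex j (Set.to_countable _).measurableSet

/-- If almost no point stays in the strip `(0, β)` forever, few points survive long. -/
lemma exists_survivors_le {X : ℕ → (Fin n → ℤ) → ℝ} {β : ℝ} {m : ℕ} (v : Fin n → ℤ)
    (hexit : ∀ᵐ x : Fin n → ℝ, ∃ j, m ≤ j ∧ X j (dyadicIndex j x) ∉ Set.Ioo 0 β) {ε : ℝ}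
    (hε : 0 < ε) : ∃ t, volume.real (survivors X β t m ∩ dyadicCube m v) ≤ ε := by
  have hanti : Antitone fun t => survivors X β t m ∩ dyadicCube m v := by
    intro s t hst x hx
    exact ⟨fun j hj hj' => hx.1 j hj (by omega), hx.2⟩
  have hlim := tendsto_measure_iInter_atTop (μ := volume)
    (fun t => ((measurableSet_survivors X β t m).inter
      (measurableSet_dyadicCube m v)).nullMeasurableSet) hanti
    ⟨0, ne_top_of_le_ne_top (volume_dyadicCube_ne_top m v) (measure_mono Set.inter_subset_right)⟩
  have hzero : volume (⋂ t, survivors X β t m ∩ dyadicCube m v) = 0 := by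
    refine measure_mono_null ?_ hexit
    intro x hx hx'
    obtain ⟨j, hj, hj'⟩ := hx'
    exact hj' ((Set.mem_iInter.1 hx j).1 j hj (by omega))
  rw [hzero] at hlim
  have := (hlim.eventually_le_const (ENNReal.ofReal_pos.2 hε)).exists
  obtain ⟨t, ht⟩ := this
  exact ⟨t, ENNReal.toReal_le_of_le_ofReal hε.le ht⟩

/-- A martingale with small jumps that starts close to `0` returns to `0`, before leaving a
slightly larger interval, on at least a quarter of the cube. -/
lemma exists_return_family {X : ℕ → (Fin n → ℤ) → ℝ} {ω : ℕ → ℝ} (hω : Antitone ω)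
    (hX : IsDyadicMartingale X)
    (hjump : ∀ j v, ∀ u ∈ children v, |X (j + 1) u - X j v| ≤ ω (j + 1)) {x₀ W : ℝ} {m : ℕ}
    {v : Fin n → ℤ} (hW0 : 0 < W) (hW : ω m ≤ W) (hm : 0 ≤ ω m)
    (hv : 0 ≤ X m v) (hv' : X m v ≤ x₀)
    (hexit : ∀ᵐ x : Fin n → ℝ,
      ∃ j, m ≤ j ∧ X j (dyadicIndex j x) ∉ Set.Ioo 0 (2 * (x₀ + W))) :
    ∃ S : Finset (ℕ × (Fin n → ℤ)),
      (∀ q ∈ S, m ≤ q.1 ∧ dyadicCube q.1 q.2 ⊆ dyadicCube m v ∧ |X q.1 q.2| ≤ ω q.1 ∧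
        ∀ x ∈ dyadicCube q.1 q.2, ∀ j, m ≤ j → j < q.1 →
          X j (dyadicIndex j x) ∈ Set.Ioo 0 (2 * (x₀ + W))) ∧
      (S : Set (ℕ × (Fin n → ℤ))).PairwiseDisjoint (fun q => dyadicCube q.1 q.2) ∧
      volume.real (dyadicCube m v) / 4 ≤ ∑ q ∈ S, volume.real (dyadicCube q.1 q.2) := by
  have hpos := volume_real_dyadicCube_pos m v
  obtain ⟨t, ht⟩ := exists_survivors_le v hexit (ε := volume.real (dyadicCube m v) / 4)
    (by positivity)
  obtain ⟨S, hS, hdisj, hineq⟩ := exists_stopping_family hω hX hjump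
    (β := 2 * (x₀ + W)) (by linarith) t m v hW (by linarith)
  refine ⟨S, hS, hdisj, ?_⟩
  by_contra! hlt
  set c := volume.real (dyadicCube m v)
  set σ := ∑ q ∈ S, volume.real (dyadicCube q.1 q.2)
  set U := volume.real (survivors X (2 * (x₀ + W)) t m ∩ dyadicCube m v)
  have hσ : 0 ≤ σ := Finset.sum_nonneg fun q _ => measureReal_nonneg
  have h1 : 2 * (x₀ + W) * (c / 2) ≤ 2 * (x₀ + W) * (c - σ - U) := by
    gcongr
    · linarith
    · linarith
  have h2 : W * σ ≤ W * (c / 4) := by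
    gcongr
  have h3 : X m v * c ≤ x₀ * c := by gcongr
  nlinarith

/-- The generation step of the construction: from a cube on which the mean is close to `α` one
descends `k` levels and then waits for the martingale to return to `α`. This yields disjoint
subcubes that cover a quarter of the cube. -/
lemma exists_good_subcubes {D : ℕ → (Fin n → ℤ) → ℝ} {ω : ℕ → ℝ} (hω : Antitone ω)
    (hω0 : ∀ j, 0 < ω j) (hD : IsDyadicMartingale D)
    (hjump : ∀ j v, ∀ u ∈ children v, |D (j + 1) u - D j v| ≤ ω (j + 1)) {α x₀ W : ℝ}
    (hexit : ∀ᵐ x : Fin n → ℝ, ∀ m, ∃ j, m ≤ j ∧ 2 * (x₀ + W) ≤ |D j (dyadicIndex j x) - α|)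
    (k m : ℕ) (v : Fin n → ℤ) (hW : ω m ≤ W) (hv : |D m v - α| + k * W ≤ x₀) :
    ∃ S : Finset (ℕ × (Fin n → ℤ)),
      (∀ q ∈ S, m + k ≤ q.1 ∧ dyadicCube q.1 q.2 ⊆ dyadicCube m v ∧ |D q.1 q.2 - α| ≤ ω q.1 ∧
        ∀ x ∈ dyadicCube q.1 q.2, ∀ j, m ≤ j → j ≤ q.1 →
          |D j (dyadicIndex j x) - α| ≤ 2 * (x₀ + W)) ∧
      (S : Set (ℕ × (Fin n → ℤ))).PairwiseDisjoint (fun q => dyadicCube q.1 q.2) ∧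
      volume.real (dyadicCube m v) / 4 ≤ ∑ q ∈ S, volume.real (dyadicCube q.1 q.2) := by
  induction k generalizing m v with
  | zero =>
    have hW0 : 0 < W := (hω0 m).trans_le hW
    rw [Nat.cast_zero, zero_mul, add_zero] at hv
    -- the orientation of the martingale is chosen so that it starts out nonnegative
    obtain ⟨s, hs, hs0⟩ : ∃ s : ℝ, |s| = 1 ∧ 0 ≤ s * (D m v - α) := by
      rcases le_total 0 (D m v - α) with h | h
      · exact ⟨1, by simp, by simpa using h⟩
      · exact ⟨-1, by simp, by simpa using h⟩
    have habs (y : ℝ) : |s * y| = |y| := by rw [abs_mul, hs, one_mul]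
    have hXm : IsDyadicMartingale fun j v => s * (D j v - α) := by
      intro j v
      rw [← Finset.mul_sum, Finset.sum_sub_distrib, hD j v, Finset.sum_const, card_children]
      simp only [nsmul_eq_mul, Nat.cast_pow, Nat.cast_ofNat]
      ring
    obtain ⟨S, hS, hdisj, hσ⟩ := exists_return_family hω hXm
      (fun j v u hu => by rw [← mul_sub, habs, sub_sub_sub_cancel_right]; exact hjump j v u hu)
      hW0 hW (hω0 m).le hs0 ((le_abs_self _).trans ((habs _).trans_le hv)) (x₀ := x₀)
      (by
        filter_upwards [hexit] with x hx
        obtain ⟨j, hj, hj'⟩ := hx m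
        refine ⟨j, hj, fun h => ?_⟩
        rw [← habs, abs_of_pos h.1] at hj'
        exact absurd h.2 (not_lt.2 hj'))
    refine ⟨S, fun q hq => ?_, hdisj, hσ⟩
    obtain ⟨a1, a2, a3, a4⟩ := hS q hq
    rw [habs] at a3
    refine ⟨by omega, a2, a3, fun x hx j hj hj' => ?_⟩
    rcases hj'.eq_or_lt with rfl | hj'
    · rw [mem_dyadicCube.1 hx]
      linarith [hω a1, abs_nonneg (D m v - α)]
    · have h := a4 x hx j hj hj'
      rw [← habs, abs_of_pos h.1]
      exact h.2.le
  | succ k ih =>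
    have hW0 : 0 < W := (hω0 m).trans_le hW
    push_cast at hv
    have step := fun u (hu : u ∈ children v) => ih (m + 1) u ((hω (Nat.le_succ m)).trans hW) (by
      have h1 := abs_sub_le (D (m + 1) u) (D m v) α
      linarith [hjump m v u hu, hω (Nat.le_succ m)])
    choose! S hS hdisj hσ using step
    refine ⟨(children v).biUnion S, ?_, pairwiseDisjoint_biUnion_children
      (fun u hu q hq => (hS u hu q hq).2.1) hdisj, ?_⟩
    · intro q hq
      obtain ⟨u, hu, hq⟩ := Finset.mem_biUnion.1 hq
      obtain ⟨a1, a2, a3, a4⟩ := hS u hu q hq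
      refine ⟨by omega, a2.trans (dyadicCube_child_subset m hu), a3, fun x hx j hj hj' => ?_⟩
      rcases hj.eq_or_lt with rfl | hj
      · rw [mem_dyadicCube.1 (dyadicCube_child_subset m hu (a2 hx))]
        nlinarith [abs_nonneg (D m v - α), Nat.cast_nonneg (α := ℝ) k]
      · exact a4 x hx j hj hj'
    · rw [sum_biUnion_children (fun u hu q hq => (hS u hu q hq).2.1)]
      have e2 : ∑ u ∈ children v, volume.real (dyadicCube (m + 1) u)
          = volume.real (dyadicCube m v) := by
        simpa using sum_children_volume_real Set.univ m v
      rw [← e2, Finset.sum_div]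
      exact Finset.sum_le_sum hσ

/-! ### Cantor sets of dyadic cubes and their dimension -/

/-- A rule `S` that assigns to each cube of the family `G` finitely many disjoint subcubes in `G`,
each at least `M` levels deeper, which together cover at least a quarter of it. A cube is given by
its level and its index. -/
structure IsBranching (G : Set (ℕ × (Fin n → ℤ)))
    (S : ℕ × (Fin n → ℤ) → Finset (ℕ × (Fin n → ℤ))) (M : ℕ) : Prop where
  mem : ∀ q ∈ G, ∀ r ∈ S q, r ∈ G
  level : ∀ q ∈ G, ∀ r ∈ S q, q.1 + M ≤ r.1
  subset : ∀ q ∈ G, ∀ r ∈ S q, dyadicCube r.1 r.2 ⊆ dyadicCube q.1 q.2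
  disjoint : ∀ q ∈ G, (S q : Set (ℕ × (Fin n → ℤ))).PairwiseDisjoint fun r => dyadicCube r.1 r.2
  quarter : ∀ q ∈ G, volume.real (dyadicCube q.1 q.2) / 4
    ≤ ∑ r ∈ S q, volume.real (dyadicCube r.1 r.2)

/-- The cubes obtained from `q` by applying the branching rule `N` times. -/
def generation (S : ℕ × (Fin n → ℤ) → Finset (ℕ × (Fin n → ℤ))) :
    ℕ → ℕ × (Fin n → ℤ) → Finset (ℕ × (Fin n → ℤ))
  | 0, q => {q}
  | N + 1, q => (S q).biUnion (generation S N)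

/-- The Cantor set of the branching rule `S` inside the closure of the cube `q`. -/
def limitSet (S : ℕ × (Fin n → ℤ) → Finset (ℕ × (Fin n → ℤ))) (q : ℕ × (Fin n → ℤ)) :
    Set (Fin n → ℝ) :=
  ⋂ N, ⋃ r ∈ generation S N q, closure (dyadicCube r.1 r.2)

/-- The natural probability distribution on the `N`-th generation of `q`: at each branching the
mass is split in proportion to volume, and inside the last generation it is spread uniformly. -/
def cantorMass (S : ℕ × (Fin n → ℤ) → Finset (ℕ × (Fin n → ℤ))) :
    ℕ → ℕ × (Fin n → ℤ) → Set (Fin n → ℝ) → ℝ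
  | 0, q, E => volume.real (E ∩ dyadicCube q.1 q.2) / volume.real (dyadicCube q.1 q.2)
  | N + 1, q, E => ∑ r ∈ S q, volume.real (dyadicCube r.1 r.2)
      / (∑ r ∈ S q, volume.real (dyadicCube r.1 r.2)) * cantorMass S N r E

variable {G : Set (ℕ × (Fin n → ℤ))} {S : ℕ × (Fin n → ℤ) → Finset (ℕ × (Fin n → ℤ))} {M : ℕ}

lemma cantorMass_nonneg (N : ℕ) (q : ℕ × (Fin n → ℤ)) (E : Set (Fin n → ℝ)) :
    0 ≤ cantorMass S N q E := by
  induction N generalizing q with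
  | zero => exact div_nonneg measureReal_nonneg measureReal_nonneg
  | succ N ih =>
    exact Finset.sum_nonneg fun r _ => mul_nonneg (div_nonneg measureReal_nonneg
      (Finset.sum_nonneg fun _ _ => measureReal_nonneg)) (ih r)

lemma cantorMass_mono (N : ℕ) (q : ℕ × (Fin n → ℤ)) {E F : Set (Fin n → ℝ)} (h : E ⊆ F) :
    cantorMass S N q E ≤ cantorMass S N q F := by
  induction N generalizing q with
  | zero =>
    refine div_le_div_of_nonneg_right (measureReal_mono (Set.inter_subset_inter_left _ h) ?_)
      measureReal_nonneg
    exact ne_top_of_le_ne_top (volume_dyadicCube_ne_top _ _) (measure_mono Set.inter_subset_right)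
  | succ N ih =>
    exact Finset.sum_le_sum fun r _ => mul_le_mul_of_nonneg_left (ih r) (div_nonneg
      measureReal_nonneg (Finset.sum_nonneg fun _ _ => measureReal_nonneg))

lemma cantorMass_biUnion_le {ι : Type*} (N : ℕ) (q : ℕ × (Fin n → ℤ)) (s : Finset ι)
    (E : ι → Set (Fin n → ℝ)) :
    cantorMass S N q (⋃ i ∈ s, E i) ≤ ∑ i ∈ s, cantorMass S N q (E i) := by
  induction N generalizing q with
  | zero =>
    simp only [cantorMass]
    rw [← Finset.sum_div, Set.iUnion₂_inter]
    exact div_le_div_of_nonneg_right (measureReal_biUnion_finset_le _ _) measureReal_nonneg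
  | succ N ih =>
    simp only [cantorMass]
    rw [Finset.sum_comm]
    refine Finset.sum_le_sum fun r _ => ?_
    rw [← Finset.mul_sum]
    exact mul_le_mul_of_nonneg_left (ih r) (div_nonneg measureReal_nonneg
      (Finset.sum_nonneg fun _ _ => measureReal_nonneg))

lemma IsBranching.sum_pos (hS : IsBranching G S M) {q : ℕ × (Fin n → ℤ)} (hq : q ∈ G) :
    0 < ∑ r ∈ S q, volume.real (dyadicCube r.1 r.2) :=
  (div_pos (volume_real_dyadicCube_pos _ _) (by norm_num)).trans_le (hS.quarter q hq)

lemma IsBranching.cantorMass_eq_one (hS : IsBranching G S M) {N : ℕ} {q : ℕ × (Fin n → ℤ)}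
    (hq : q ∈ G) {E : Set (Fin n → ℝ)}
    (hE : ∀ r ∈ generation S N q, dyadicCube r.1 r.2 ⊆ E) : cantorMass S N q E = 1 := by
  induction N generalizing q with
  | zero =>
    have := hE q (by simp [generation])
    simp only [cantorMass]
    rw [Set.inter_eq_right.2 this, div_self (volume_real_dyadicCube_pos _ _).ne']
  | succ N ih =>
    simp only [cantorMass]
    rw [Finset.sum_congr rfl fun r hr => by
      rw [ih (hS.mem q hq r hr) fun t ht => hE t (Finset.mem_biUnion.2 ⟨r, hr, ht⟩), mul_one],
      ← Finset.sum_div, div_self (hS.sum_pos hq).ne']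

lemma IsBranching.cantorMass_le_one (hS : IsBranching G S M) (N : ℕ) {q : ℕ × (Fin n → ℤ)}
    (hq : q ∈ G) (E : Set (Fin n → ℝ)) : cantorMass S N q E ≤ 1 :=
  (cantorMass_mono N q (Set.subset_univ E)).trans_eq
    (hS.cantorMass_eq_one hq fun _ _ => Set.subset_univ _)

lemma IsBranching.cantorMass_eq_zero (hS : IsBranching G S M) {N : ℕ} {q : ℕ × (Fin n → ℤ)}
    (hq : q ∈ G) {E : Set (Fin n → ℝ)} (hE : Disjoint E (dyadicCube q.1 q.2)) :
    cantorMass S N q E = 0 := by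
  induction N generalizing q with
  | zero => simp [cantorMass, hE.inter_eq]
  | succ N ih =>
    simp only [cantorMass]
    refine Finset.sum_eq_zero fun r hr => ?_
    rw [ih (hS.mem q hq r hr) (hE.mono_right (hS.subset q hq r hr)), mul_zero]

lemma volume_real_dyadicCube_eq_rpow (j : ℕ) (v : Fin n → ℤ) :
    volume.real (dyadicCube j v) = (2 : ℝ) ^ (-((n : ℝ) * j)) := by
  rw [volume_real_dyadicCube, Real.rpow_neg two_pos.le]
  norm_cast

/-- The Frostman estimate: the factor `4` lost at each branching is compensated by the `M` levels
gained. -/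
lemma IsBranching.cantorMass_dyadicCube_le (hS : IsBranching G S M) {d : ℝ} (hd : 0 ≤ d)
    (hdn : d ≤ n) (hM : (4 : ℝ) ≤ 2 ^ (((n : ℝ) - d) * M)) (N : ℕ) {q : ℕ × (Fin n → ℤ)}
    (hq : q ∈ G) (f : ℕ) (w : Fin n → ℤ) :
    cantorMass S N q (dyadicCube f w) ≤ 4 * 2 ^ (d * ((q.1 : ℝ) - f)) := by
  induction N generalizing q with
  | zero =>
    rcases le_total f q.1 with hf | hf
    · have : (1 : ℝ) ≤ 2 ^ (d * ((q.1 : ℝ) - f)) :=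
        Real.one_le_rpow one_le_two (mul_nonneg hd (sub_nonneg.2 (by exact_mod_cast hf)))
      linarith [hS.cantorMass_le_one 0 hq (dyadicCube f w)]
    · simp only [cantorMass]
      rw [div_le_iff₀ (volume_real_dyadicCube_pos _ _)]
      refine (measureReal_mono Set.inter_subset_left (volume_dyadicCube_ne_top _ _)).trans ?_
      rw [volume_real_dyadicCube_eq_rpow, volume_real_dyadicCube_eq_rpow, mul_assoc,
        ← Real.rpow_add two_pos]
      have hf' : (q.1 : ℝ) ≤ f := by exact_mod_cast hf
      have : (2 : ℝ) ^ (-((n : ℝ) * f)) ≤ 2 ^ (d * ((q.1 : ℝ) - f) + -((n : ℝ) * q.1)) :=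
        Real.rpow_le_rpow_of_exponent_le one_le_two (by nlinarith)
      linarith [Real.rpow_pos_of_pos two_pos (d * ((q.1 : ℝ) - f) + -((n : ℝ) * q.1))]
  | succ N ih =>
    rcases le_total f q.1 with hf | hf
    · have : (1 : ℝ) ≤ 2 ^ (d * ((q.1 : ℝ) - f)) :=
        Real.one_le_rpow one_le_two (mul_nonneg hd (sub_nonneg.2 (by exact_mod_cast hf)))
      linarith [hS.cantorMass_le_one (N + 1) hq (dyadicCube f w)]
    have hf' : (q.1 : ℝ) ≤ f := by exact_mod_cast hf
    have hσ := hS.sum_pos hq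
    have hσ' := hS.quarter q hq
    simp only [cantorMass]
    set σ := ∑ r ∈ S q, volume.real (dyadicCube r.1 r.2)
    have hq0 := volume_real_dyadicCube_pos q.1 q.2
    by_cases hcase : ∃ r ∈ S q, dyadicCube f w ⊆ dyadicCube r.1 r.2
    · -- the cube lies inside one cube of the next generation
      obtain ⟨r, hr, hsub⟩ := hcase
      rw [Finset.sum_eq_single_of_mem r hr fun t ht htr => by
        rw [hS.cantorMass_eq_zero (hS.mem q hq t ht)
          ((hS.disjoint q hq hr ht htr.symm).mono_left hsub), mul_zero]]
      have hlev : (q.1 : ℝ) + M ≤ r.1 := by exact_mod_cast hS.level q hq r hr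
      have h1 : volume.real (dyadicCube r.1 r.2) / σ
          ≤ 4 * 2 ^ ((n : ℝ) * ((q.1 : ℝ) - r.1)) := by
        rw [div_le_iff₀ hσ]
        calc volume.real (dyadicCube r.1 r.2)
            = 2 ^ ((n : ℝ) * ((q.1 : ℝ) - r.1)) * volume.real (dyadicCube q.1 q.2) := by
              rw [volume_real_dyadicCube_eq_rpow, volume_real_dyadicCube_eq_rpow,
                ← Real.rpow_add two_pos]
              ring_nf
          _ ≤ 2 ^ ((n : ℝ) * ((q.1 : ℝ) - r.1)) * (4 * σ) := by
              gcongr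
              linarith
          _ = _ := by ring
      calc _ ≤ 4 * 2 ^ ((n : ℝ) * ((q.1 : ℝ) - r.1)) * (4 * 2 ^ (d * ((r.1 : ℝ) - f))) :=
            mul_le_mul h1 (ih (hS.mem q hq r hr)) (cantorMass_nonneg _ _ _) (by positivity)
        _ ≤ 4 * 2 ^ ((n : ℝ) * ((q.1 : ℝ) - r.1)) * (2 ^ (((n : ℝ) - d) * M)
              * 2 ^ (d * ((r.1 : ℝ) - f))) := by gcongr
        _ = 4 * 2 ^ ((n : ℝ) * ((q.1 : ℝ) - r.1) + (((n : ℝ) - d) * M + d * ((r.1 : ℝ) - f))) := by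
            rw [Real.rpow_add two_pos, Real.rpow_add two_pos]
            ring
        _ ≤ 4 * 2 ^ (d * ((q.1 : ℝ) - f)) := by
            gcongr
            · exact one_le_two
            · nlinarith
    · -- the cube consists of cubes of the next generation and of points of mass zero
      push Not at hcase
      have h1 : ∀ r ∈ S q, volume.real (dyadicCube r.1 r.2) / σ * cantorMass S N r (dyadicCube f w)
          ≤ volume.real (dyadicCube f w ∩ dyadicCube r.1 r.2) / σ := by
        intro r hr
        rw [div_mul_eq_mul_div]
        gcongr
        by_cases hd : Disjoint (dyadicCube f w) (dyadicCube r.1 r.2)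
        · rw [hS.cantorMass_eq_zero (hS.mem q hq r hr) hd, mul_zero]
          exact measureReal_nonneg
        · obtain ⟨x, hx, hx'⟩ := Set.not_disjoint_iff.1 hd
          have hlt : f ≤ r.1 := by
            by_contra! hlt
            exact hcase r hr (dyadicCube_subset_of_mem hlt.le hx hx')
          rw [Set.inter_eq_right.2 (dyadicCube_subset_of_mem hlt hx' hx)]
          exact mul_le_of_le_one_right measureReal_nonneg
            (hS.cantorMass_le_one N (hS.mem q hq r hr) _)
      refine (Finset.sum_le_sum h1).trans ?_
      rw [← Finset.sum_div, div_le_iff₀ hσ]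
      have h2 : ∑ r ∈ S q, volume.real (dyadicCube f w ∩ dyadicCube r.1 r.2)
          ≤ volume.real (dyadicCube f w) := by
        rw [← measureReal_biUnion_finset
          (fun r hr t ht hrt => (hS.disjoint q hq hr ht hrt).mono Set.inter_subset_right
            Set.inter_subset_right)
          (fun r _ => (measurableSet_dyadicCube _ _).inter (measurableSet_dyadicCube _ _))
          (fun r _ => ne_top_of_le_ne_top (volume_dyadicCube_ne_top f w)
            (measure_mono Set.inter_subset_left))]
        exact measureReal_mono (Set.iUnion₂_subset fun _ _ => Set.inter_subset_left)
          (volume_dyadicCube_ne_top _ _)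
      calc _ ≤ volume.real (dyadicCube f w) := h2
        _ = 2 ^ ((n : ℝ) * ((q.1 : ℝ) - f)) * volume.real (dyadicCube q.1 q.2) := by
            rw [volume_real_dyadicCube_eq_rpow, volume_real_dyadicCube_eq_rpow,
              ← Real.rpow_add two_pos]
            ring_nf
        _ ≤ 2 ^ (d * ((q.1 : ℝ) - f)) * (4 * σ) := by
            refine mul_le_mul (Real.rpow_le_rpow_of_exponent_le one_le_two ?_) (by linarith) hq0.le
              (by positivity)
            nlinarith
        _ = _ := by ring

/-- Balls of radius at most the side of a dyadic cube meet at most `3 ^ n` cubes of that side. -/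
lemma ball_subset_biUnion_dyadicCube (x : Fin n → ℝ) {r : ℝ} {j : ℕ} (hr : r * 2 ^ j ≤ 1) :
    Metric.ball x r ⊆ ⋃ e ∈ Fintype.piFinset fun _ : Fin n => ({-1, 0, 1} : Finset ℤ),
      dyadicCube j (dyadicIndex j x + e) := by
  intro y hy
  simp only [Set.mem_iUnion, exists_prop]
  refine ⟨dyadicIndex j y - dyadicIndex j x, Fintype.mem_piFinset.2 fun i => ?_, ?_⟩
  · have h : |y i - x i| < r := by
      have := (dist_le_pi_dist y x i).trans_lt (Metric.mem_ball.1 hy)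
      rwa [Real.dist_eq] at this
    have h2 : |y i * 2 ^ j - x i * 2 ^ j| < 1 := by
      rw [← sub_mul, abs_mul, abs_of_pos (pow_pos (two_pos (α := ℝ)) j)]
      exact (mul_lt_mul_of_pos_right h (by positivity)).trans_le hr
    rw [abs_lt] at h2
    have e1 : ⌊y i * 2 ^ j⌋ < ⌊x i * 2 ^ j⌋ + 2 := by
      have := Int.floor_le (y i * (2 : ℝ) ^ j)
      have := Int.lt_floor_add_one (x i * (2 : ℝ) ^ j)
      have : (⌊y i * 2 ^ j⌋ : ℝ) < ⌊x i * 2 ^ j⌋ + 2 := by linarith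
      exact_mod_cast this
    have e2 : ⌊x i * 2 ^ j⌋ < ⌊y i * 2 ^ j⌋ + 2 := by
      have := Int.floor_le (x i * (2 : ℝ) ^ j)
      have := Int.lt_floor_add_one (y i * (2 : ℝ) ^ j)
      have : (⌊x i * 2 ^ j⌋ : ℝ) < ⌊y i * 2 ^ j⌋ + 2 := by linarith
      exact_mod_cast this
    simp only [Pi.sub_apply, dyadicIndex, Finset.mem_insert, Finset.mem_singleton]
    omega
  · rw [add_sub_cancel]
    exact mem_dyadicCube_dyadicIndex j y

lemma IsBranching.exists_cantorMass_ball_le (hS : IsBranching G S M) {d : ℝ} (hd : 0 ≤ d)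
    (hdn : d ≤ n) (hM : (4 : ℝ) ≤ 2 ^ (((n : ℝ) - d) * M)) {q : ℕ × (Fin n → ℤ)} (hq : q ∈ G) :
    ∃ C : ℝ, 0 < C ∧ ∀ N x r, 0 < r → cantorMass S N q (Metric.ball x r) ≤ C * r ^ d := by
  refine ⟨3 ^ n * (4 * 2 ^ (d * (q.1 + 1))), by positivity, fun N x r hr => ?_⟩
  have h2 : (1 : ℝ) ≤ 2 ^ (d * ((q.1 : ℝ) + 1)) :=
    Real.one_le_rpow one_le_two (by positivity)
  rcases le_total 1 r with h1 | h1
  · have h3 : (1 : ℝ) ≤ 3 ^ n := one_le_pow₀ (by norm_num)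
    have h4 : 1 ≤ r ^ d := Real.one_le_rpow h1 hd
    calc _ ≤ (1 : ℝ) := hS.cantorMass_le_one N hq _
      _ ≤ 3 ^ n * (4 * 2 ^ (d * ((q.1 : ℝ) + 1))) * r ^ d :=
        one_le_mul_of_one_le_of_one_le
          (one_le_mul_of_one_le_of_one_le h3 (by linarith)) h4
  · obtain ⟨j, hj1, hj2⟩ := exists_nat_pow_near (one_le_inv_iff₀.2 ⟨hr, h1⟩) one_lt_two
    have hj1' : r * 2 ^ j ≤ 1 := by
      have := mul_le_mul_of_nonneg_left hj1 hr.le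
      rwa [mul_inv_cancel₀ hr.ne'] at this
    have hj2' : 1 < r * 2 ^ (j + 1) := by
      have := mul_lt_mul_of_pos_left hj2 hr
      rwa [mul_inv_cancel₀ hr.ne'] at this
    refine (cantorMass_mono N q (ball_subset_biUnion_dyadicCube x hj1')).trans ?_
    refine (cantorMass_biUnion_le N q _ _).trans ?_
    refine (Finset.sum_le_card_nsmul _ _ (4 * 2 ^ (d * ((q.1 : ℝ) - j)))
      fun e _ => hS.cantorMass_dyadicCube_le hd hdn hM N hq j _).trans ?_
    have hcard : (Fintype.piFinset fun _ : Fin n => ({-1, 0, 1} : Finset ℤ)).card = 3 ^ n := by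
      simp
    rw [hcard, nsmul_eq_mul]
    push_cast
    rw [mul_assoc ((3 : ℝ) ^ n), mul_assoc (4 : ℝ)]
    gcongr
    calc (2 : ℝ) ^ (d * ((q.1 : ℝ) - j))
        = 2 ^ (d * ((q.1 : ℝ) + 1)) * (2 ^ (-((j : ℝ) + 1))) ^ d := by
          rw [← Real.rpow_mul two_pos.le, ← Real.rpow_add two_pos]
          ring_nf
      _ ≤ 2 ^ (d * ((q.1 : ℝ) + 1)) * r ^ d := by
          gcongr
          rw [Real.rpow_neg two_pos.le, inv_le_iff_one_le_mul₀ (by positivity)]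
          exact_mod_cast hj2'.le

lemma generation_add (k l : ℕ) (q : ℕ × (Fin n → ℤ)) :
    generation S (k + l) q = (generation S k q).biUnion (generation S l) := by
  induction k generalizing q with
  | zero => simp [generation]
  | succ k ih =>
    rw [Nat.succ_add, generation, generation, Finset.biUnion_biUnion]
    exact Finset.biUnion_congr rfl fun r _ => ih r

lemma IsBranching.generation_mem (hS : IsBranching G S M) {N : ℕ} {q r : ℕ × (Fin n → ℤ)}
    (hq : q ∈ G) (hr : r ∈ generation S N q) :
    r ∈ G ∧ q.1 + N * M ≤ r.1 ∧ dyadicCube r.1 r.2 ⊆ dyadicCube q.1 q.2 := by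
  induction N generalizing q with
  | zero =>
    obtain rfl : r = q := by simpa [generation] using hr
    exact ⟨hq, by simp, subset_rfl⟩
  | succ N ih =>
    obtain ⟨t, ht, hr⟩ := Finset.mem_biUnion.1 hr
    obtain ⟨h1, h2, h3⟩ := ih (hS.mem q hq t ht) hr
    refine ⟨h1, ?_, h3.trans (hS.subset q hq t ht)⟩
    have := hS.level q hq t ht
    rw [add_mul]
    omega

lemma limitSet_subset_closure (q : ℕ × (Fin n → ℤ)) :
    limitSet S q ⊆ closure (dyadicCube q.1 q.2) := by
  intro x hx
  simpa [generation] using Set.mem_iInter.1 hx 0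

/-- A set is contained in a ball whose radius to the power `d` exceeds the `d`-th power of the
diameter by an arbitrarily small amount. -/
lemma exists_ball_superset (t : Set (Fin n → ℝ)) {d : ℝ} (hd : 0 < d) {δ : NNReal} (hδ : 0 < δ)
    (hfin : ⨆ _ : t.Nonempty, Metric.ediam t ^ d ≠ ⊤) :
    ∃ x : Fin n → ℝ, ∃ r : ℝ, 0 < r ∧ t ⊆ Metric.ball x r ∧
      ENNReal.ofReal (r ^ d) ≤ (⨆ _ : t.Nonempty, Metric.ediam t ^ d) + δ := by
  have hδi : (0 : ℝ) < δ := hδ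
  have hr (D : ℝ) (hD : 0 ≤ D) : ((D ^ d + δ) ^ d⁻¹) ^ d = D ^ d + δ :=
    Real.rpow_inv_rpow (by positivity) hd.ne'
  rcases t.eq_empty_or_nonempty with rfl | ⟨x, hx⟩
  · refine ⟨0, (0 ^ d + δ) ^ d⁻¹, by positivity, by simp, ?_⟩
    rw [hr 0 le_rfl]
    simp [hd.ne']
  · have hne : t.Nonempty := ⟨x, hx⟩
    have hfin' : Metric.ediam t ≠ ⊤ := by
      intro htop
      simp [hne, htop, ENNReal.top_rpow_of_pos hd] at hfin
    set D := (Metric.ediam t).toReal with hDdef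
    have hD : 0 ≤ D := ENNReal.toReal_nonneg
    refine ⟨x, (D ^ d + δ) ^ d⁻¹, by positivity, fun y hy => ?_, ?_⟩
    · have h1 : dist y x ≤ D := by
        rw [dist_edist]
        exact ENNReal.toReal_mono hfin' (Metric.edist_le_ediam_of_mem hy hx)
      refine h1.trans_lt ?_
      rw [Real.lt_rpow_inv_iff_of_pos hD (by positivity) hd]
      linarith
    · rw [hr D hD, ENNReal.ofReal_add (by positivity) hδi.le]
      simp only [hne, iSup_pos, ENNReal.ofReal_coe_nnreal]
      rw [← ENNReal.ofReal_rpow_of_nonneg hD hd.le, ENNReal.ofReal_toReal hfin']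

/-- The mass distribution principle, with the distributions on the finite generations in place of
a limit measure: compactness reduces a cover of the Cantor set to a finite cover of one
generation. -/
lemma IsBranching.le_dimH_limitSet (hS : IsBranching G S M) {d : NNReal} (hd : 0 < d)
    (hdn : (d : ℝ) ≤ n) (hM : (4 : ℝ) ≤ 2 ^ (((n : ℝ) - d) * M)) {q : ℕ × (Fin n → ℤ)}
    (hq : q ∈ G) : (d : ENNReal) ≤ dimH (limitSet S q) := by
  obtain ⟨C, hC, hball⟩ := hS.exists_cantorMass_ball_le d.2 hdn hM hq
  by_contra! hlt
  have hzero := hausdorffMeasure_of_dimH_lt hlt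
  have hd' : (0 : ℝ) < d := hd
  obtain ⟨t, ht, hsum⟩ : ∃ t : ℕ → Set (Fin n → ℝ), limitSet S q ⊆ ⋃ i, t i ∧
      ∑' i, ⨆ _ : (t i).Nonempty, Metric.ediam (t i) ^ (d : ℝ) < ENNReal.ofReal (1 / (2 * C)) := by
    rw [Measure.hausdorffMeasure_apply] at hzero
    have h1 := (iSup₂_le_iff.1 hzero.le 1 one_pos).trans_lt
      (ENNReal.ofReal_pos.2 (by positivity : 0 < 1 / (2 * C)))
    simp only [iInf_lt_iff] at h1
    obtain ⟨t, ht, _, h⟩ := h1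
    exact ⟨t, ht, h⟩
  obtain ⟨δ, hδ0, hδ⟩ := ENNReal.exists_pos_sum_of_countable
    (ENNReal.ofReal_pos.2 (by positivity : 0 < 1 / (2 * C))).ne' ℕ
  have hcover : ∀ i, ∃ x : Fin n → ℝ, ∃ r : ℝ, 0 < r ∧ t i ⊆ Metric.ball x r ∧
      ENNReal.ofReal (r ^ (d : ℝ))
        ≤ (⨆ _ : (t i).Nonempty, Metric.ediam (t i) ^ (d : ℝ)) + δ i := by
    exact fun i => exists_ball_superset (t i) hd' (hδ0 i)
      ((ENNReal.le_tsum i).trans_lt (hsum.trans ENNReal.ofReal_lt_top)).ne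
  choose x r hr0 htr hr using hcover
  set V : ℕ → Set (Fin n → ℝ) := fun N => ⋃ p ∈ generation S N q, closure (dyadicCube p.1 p.2)
    with hV
  have hVc (N : ℕ) : IsCompact (V N) :=
    (generation S N q).isCompact_biUnion fun p _ => isCompact_closure_dyadicCube _ _
  have hVanti : Antitone V := by
    refine antitone_nat_of_succ_le fun N => ?_
    refine Set.iUnion₂_subset fun p hp => ?_
    rw [generation_add N 1] at hp
    obtain ⟨u, hu, hp⟩ := Finset.mem_biUnion.1 hp
    intro y hy
    exact Set.mem_iUnion₂.2
      ⟨u, hu, closure_mono (hS.generation_mem (hS.generation_mem hq hu).1 hp).2.2 hy⟩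
  have hopen : IsOpen (⋃ i, Metric.ball (x i) (r i)) := isOpen_iUnion fun i => Metric.isOpen_ball
  obtain ⟨N, hN⟩ := exists_subset_nhds_of_isCompact' hVanti.directed_ge hVc
    (fun N => (hVc N).isClosed) fun y hy =>
      hopen.mem_nhds (Set.iUnion_mono htr (ht hy))
  obtain ⟨s, hs⟩ := (hVc N).elim_finite_subcover _ (fun i => Metric.isOpen_ball) hN
  have h1 : (1 : ℝ) ≤ ∑ i ∈ s, C * r i ^ (d : ℝ) := by
    rw [← hS.cantorMass_eq_one (N := N) hq (E := ⋃ i ∈ s, Metric.ball (x i) (r i)) fun p hp y hy =>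
      hs (Set.mem_iUnion₂.2 ⟨p, hp, subset_closure hy⟩)]
    exact (cantorMass_biUnion_le N q s _).trans
      (Finset.sum_le_sum fun i _ => hball N (x i) (r i) (hr0 i))
  rw [← Finset.mul_sum] at h1
  have h2 : ENNReal.ofReal (∑ i ∈ s, r i ^ (d : ℝ)) < ENNReal.ofReal (1 / C) := by
    rw [ENNReal.ofReal_sum_of_nonneg fun i _ => Real.rpow_nonneg (hr0 i).le _]
    calc _ ≤ ∑ i ∈ s, ((⨆ _ : (t i).Nonempty, Metric.ediam (t i) ^ (d : ℝ)) + (δ i : ENNReal)) :=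
          Finset.sum_le_sum fun i _ => hr i
      _ ≤ ∑' i, ((⨆ _ : (t i).Nonempty, Metric.ediam (t i) ^ (d : ℝ)) + (δ i : ENNReal)) :=
          ENNReal.sum_le_tsum s
      _ < ENNReal.ofReal (1 / (2 * C)) + ENNReal.ofReal (1 / (2 * C)) := by
          rw [ENNReal.tsum_add]
          exact ENNReal.add_lt_add hsum hδ
      _ = ENNReal.ofReal (1 / C) := by
          rw [← ENNReal.ofReal_add (by positivity) (by positivity)]
          congr 1
          field_simp
          norm_num
  rw [ENNReal.ofReal_lt_ofReal_iff (by positivity), lt_div_iff₀' hC] at h2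
  exact absurd h1 (not_le.2 h2)

/-- Along the dyadic cubes that contain a point of the Cantor set, the values of `D` converge to
`α` if they stay within `b j` of `α` between a cube of level `j` and its successors. -/
lemma IsBranching.tendsto_of_mem_limitSet (hS : IsBranching G S M) (hM : 0 < M)
    {D : ℕ → (Fin n → ℤ) → ℝ} {α : ℝ} {b η : ℕ → ℝ} (hb : Antitone b)
    (hb0 : Tendsto b atTop (𝓝 0)) (hη : Tendsto η atTop (𝓝 0))
    (hadj : ∀ j u v, (∀ i, |u i - v i| ≤ 1) → |D j u - D j v| ≤ η j)
    (hband : ∀ q ∈ G, ∀ r ∈ S q, ∀ x ∈ dyadicCube r.1 r.2, ∀ j, q.1 ≤ j → j ≤ r.1 →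
      |D j (dyadicIndex j x) - α| ≤ b q.1)
    (hgood : ∀ q ∈ G, |D q.1 q.2 - α| ≤ b q.1)
    {q : ℕ × (Fin n → ℤ)} (hq : q ∈ G) {x : Fin n → ℝ} (hx : x ∈ limitSet S q) :
    Tendsto (fun j => D j (dyadicIndex j x)) atTop (𝓝 α) := by
  have hlater : ∀ N, ∀ q ∈ G, ∀ r ∈ generation S N q, ∀ x ∈ dyadicCube r.1 r.2, ∀ j, q.1 ≤ j →
      j ≤ r.1 → |D j (dyadicIndex j x) - α| ≤ b q.1 := by
    intro N
    induction N with
    | zero =>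
      intro q hq r hr x hx j hj hj'
      obtain rfl : r = q := by simpa [generation] using hr
      obtain rfl : j = r.1 := le_antisymm hj' hj
      rw [mem_dyadicCube.1 hx]
      exact hgood r hq
    | succ N ih =>
      intro q hq r hr x hx j hj hj'
      obtain ⟨t, ht, hr⟩ := Finset.mem_biUnion.1 hr
      have htG := hS.mem q hq t ht
      rcases le_total j t.1 with h | h
      · exact hband q hq t ht x ((hS.generation_mem htG hr).2.2 hx) j hj h
      · refine (ih t htG r hr x hx j h hj').trans (hb ?_)
        have := hS.level q hq t ht
        omega
  rw [Metric.tendsto_atTop]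
  intro ε hε
  obtain ⟨k, hk⟩ := (hb0.eventually_lt_const (half_pos hε)).exists
  obtain ⟨J, hJ⟩ := eventually_atTop.1 (hη.eventually_lt_const (half_pos hε))
  refine ⟨max J ((generation S k q).sup Prod.fst), fun j hj => ?_⟩
  have hj1 := (le_max_left _ _).trans hj
  have hj2 := (le_max_right _ _).trans hj
  -- some generation after the `k`-th consists of cubes of level at least `j`
  obtain ⟨r, hr, hxr⟩ := Set.mem_iUnion₂.1 (Set.mem_iInter.1 hx (k + j))
  have hlev := (hS.generation_mem hq hr).2.1
  have hjr : j ≤ r.1 := by nlinarith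
  rw [generation_add] at hr
  obtain ⟨t, ht, hr⟩ := Finset.mem_biUnion.1 hr
  obtain ⟨htG, htlev, -⟩ := hS.generation_mem hq ht
  obtain ⟨y, hy⟩ := dyadicCube_nonempty r.1 r.2
  have h1 := hlater j t htG r hr y hy j
    ((Finset.le_sup (f := Prod.fst) ht).trans hj2) hjr
  have h2 := hadj j (dyadicIndex j x) (dyadicIndex j y)
    (abs_dyadicIndex_sub_le hjr hxr (subset_closure hy))
  have h3 : b t.1 ≤ b k := hb (by nlinarith)
  rw [Real.dist_eq]
  have h4 := abs_sub_le (D j (dyadicIndex j x)) (D j (dyadicIndex j y)) α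
  linarith [hJ j hj1]

/-- A dyadic martingale with vanishing increments whose paths almost surely tend to `0` or `1`
tends to `α` on a set of large dimension inside every small cube on which it is close to `α`. -/
lemma exists_le_dimH_tendsto {D : ℕ → (Fin n → ℤ) → ℝ} {ω : ℕ → ℝ} (hω : Antitone ω)
    (hω0 : ∀ j, 0 < ω j) (hωlim : Tendsto ω atTop (𝓝 0)) (hD : IsDyadicMartingale D)
    (hjump : ∀ j v, ∀ u ∈ children v, |D (j + 1) u - D j v| ≤ ω (j + 1))
    (hadj : ∀ j u v, (∀ i, |u i - v i| ≤ 1) → |D j u - D j v| ≤ ω j)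
    (hlim : ∀ᵐ x : Fin n → ℝ, Tendsto (fun j => D j (dyadicIndex j x)) atTop (𝓝 0) ∨
      Tendsto (fun j => D j (dyadicIndex j x)) atTop (𝓝 1))
    {α : ℝ} (hα0 : 0 < α) (hα1 : α < 1) {d : NNReal} (hd : 0 < d) (hdn : (d : ℝ) < n) :
    ∃ m₀, ∀ m, m₀ ≤ m → ∀ v, |D m v - α| ≤ ω m →
      (d : ENNReal) ≤ dimH {x ∈ closure (dyadicCube m v) |
        Tendsto (fun j => D j (dyadicIndex j x)) atTop (𝓝 α)} := by
  obtain ⟨M, hM0, hM⟩ : ∃ M : ℕ, 0 < M ∧ (4 : ℝ) ≤ 2 ^ (((n : ℝ) - d) * M) := by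
    obtain ⟨M, hM⟩ := exists_nat_gt (2 / ((n : ℝ) - d))
    have hnd : 0 < (n : ℝ) - d := sub_pos.2 hdn
    have hM' := (div_lt_iff₀' hnd).1 hM
    refine ⟨M, ?_, ?_⟩
    · have : (0 : ℝ) < M := (by positivity : (0 : ℝ) < 2 / ((n : ℝ) - d)).trans hM
      exact_mod_cast this
    · calc (4 : ℝ) = 2 ^ (2 : ℝ) := by norm_num
        _ ≤ _ := Real.rpow_le_rpow_of_exponent_le one_le_two hM'.le
  set b : ℕ → ℝ := fun j => 2 * ((M + 1) * ω j + ω j) with hb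
  have hbanti : Antitone b := fun i j hij => by
    have := hω hij
    simp only [hb]
    gcongr
  have hblim : Tendsto b atTop (𝓝 0) := by
    have := ((hωlim.const_mul ((M : ℝ) + 1)).add hωlim).const_mul 2
    simpa using this
  obtain ⟨m₀, hm₀⟩ := (hblim.eventually_lt_const (lt_min hα0 (sub_pos.2 hα1))).exists
  have hωb (j : ℕ) : ω j ≤ b j := by
    have := hω0 j
    simp only [hb]
    nlinarith [Nat.cast_nonneg (α := ℝ) M]
  have hstep : ∀ q ∈ {q : ℕ × (Fin n → ℤ) | m₀ ≤ q.1 ∧ |D q.1 q.2 - α| ≤ ω q.1},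
      ∃ S : Finset (ℕ × (Fin n → ℤ)),
      (∀ r ∈ S, q.1 + M ≤ r.1 ∧ dyadicCube r.1 r.2 ⊆ dyadicCube q.1 q.2 ∧
        |D r.1 r.2 - α| ≤ ω r.1 ∧ ∀ x ∈ dyadicCube r.1 r.2, ∀ j, q.1 ≤ j → j ≤ r.1 →
          |D j (dyadicIndex j x) - α| ≤ b q.1) ∧
      (S : Set (ℕ × (Fin n → ℤ))).PairwiseDisjoint (fun r => dyadicCube r.1 r.2) ∧
      volume.real (dyadicCube q.1 q.2) / 4 ≤ ∑ r ∈ S, volume.real (dyadicCube r.1 r.2) := by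
    intro q hq
    refine exists_good_subcubes hω hω0 hD hjump ?_ M q.1 q.2 le_rfl (by linarith [hq.2])
    have hlt := (hbanti hq.1).trans_lt hm₀
    filter_upwards [hlim] with x hx m
    have : ∀ᶠ j in atTop, b q.1 ≤ |D j (dyadicIndex j x) - α| := by
      rcases hx with hx | hx
      · refine ((hx.sub_const α).abs.eventually_const_lt ?_).mono fun _ h => h.le
        rw [zero_sub, abs_neg, abs_of_pos hα0]
        exact hlt.trans_le (min_le_left _ _)
      · refine ((hx.sub_const α).abs.eventually_const_lt ?_).mono fun _ h => h.le
        rw [abs_of_pos (sub_pos.2 hα1)]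
        exact hlt.trans_le (min_le_right _ _)
    obtain ⟨j, hj, hj'⟩ := (this.and (eventually_ge_atTop m)).exists
    exact ⟨j, hj', hj⟩
  choose! S hS1 hS2 hS3 using hstep
  have hS : IsBranching {q : ℕ × (Fin n → ℤ) | m₀ ≤ q.1 ∧ |D q.1 q.2 - α| ≤ ω q.1} S M :=
    { mem := fun q hq r hr =>
        ⟨by have := (hS1 q hq r hr).1; have := hq.1; omega, (hS1 q hq r hr).2.2.1⟩
      level := fun q hq r hr => (hS1 q hq r hr).1
      subset := fun q hq r hr => (hS1 q hq r hr).2.1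
      disjoint := hS2
      quarter := hS3 }
  refine ⟨m₀, fun m hm v hv => ?_⟩
  refine (hS.le_dimH_limitSet hd hdn.le hM (q := (m, v)) ⟨hm, hv⟩).trans (dimH_mono fun x hx => ?_)
  exact ⟨limitSet_subset_closure _ hx, hS.tendsto_of_mem_limitSet hM0 hbanti hblim hωlim hadj
    (fun q hq r hr => (hS1 q hq r hr).2.2.2) (fun q hq => hq.2.trans (hωb _))
    (q := (m, v)) ⟨hm, hv⟩ hx⟩

/-! ### Densities of dyadic cubes -/

/-- The density of `B` in the dyadic cube of index `v` at level `j`. -/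
def dyadicDensity (B : Set (Fin n → ℝ)) (j : ℕ) (v : Fin n → ℤ) : ℝ :=
  volume.real (B ∩ dyadicCube j v) / volume.real (dyadicCube j v)

lemma dyadicDensity_nonneg (B : Set (Fin n → ℝ)) (j : ℕ) (v : Fin n → ℤ) :
    0 ≤ dyadicDensity B j v := div_nonneg measureReal_nonneg measureReal_nonneg

lemma dyadicDensity_le_one (B : Set (Fin n → ℝ)) (j : ℕ) (v : Fin n → ℤ) :
    dyadicDensity B j v ≤ 1 :=
  div_le_one_of_le₀ (measureReal_mono Set.inter_subset_right (volume_dyadicCube_ne_top j v))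
    measureReal_nonneg

lemma dyadicDensity_mul (B : Set (Fin n → ℝ)) (j : ℕ) (v : Fin n → ℤ) :
    dyadicDensity B j v * volume.real (dyadicCube j v) = volume.real (B ∩ dyadicCube j v) :=
  div_mul_cancel₀ _ (volume_real_dyadicCube_pos j v).ne'

lemma isDyadicMartingale_dyadicDensity (B : Set (Fin n → ℝ)) :
    IsDyadicMartingale (dyadicDensity B) := by
  intro j v
  have h (u : Fin n → ℤ) : dyadicDensity B (j + 1) u
      = 2 ^ n * (volume.real (B ∩ dyadicCube (j + 1) u) / volume.real (dyadicCube j v)) := by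
    rw [dyadicDensity, ← volume_real_child j u v]
    field_simp
  simp only [h]
  rw [← Finset.mul_sum, ← Finset.sum_div, sum_children_volume_real]
  rfl

lemma dyadicDensity_compl {B : Set (Fin n → ℝ)} (hB : NullMeasurableSet B) (j : ℕ)
    (v : Fin n → ℤ) : dyadicDensity Bᶜ j v = 1 - dyadicDensity B j v := by
  have h := measureReal_inter_add_sdiff₀ (μ := volume) (s := dyadicCube j v) hB
    (volume_dyadicCube_ne_top j v)
  have h0 := (volume_real_dyadicCube_pos j v).ne'
  rw [dyadicDensity, dyadicDensity, Set.inter_comm Bᶜ, ← Set.sdiff_eq, Set.inter_comm B]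
  field_simp
  linarith

lemma dyadicCube_ae_eq_closedBall (j : ℕ) (v : Fin n → ℤ) :
    dyadicCube j v =ᵐ[volume]
      Metric.closedBall (fun i => (v i + 1 / 2) / (2 : ℝ) ^ j) (((2 : ℝ) ^ j)⁻¹ / 2) := by
  rw [dyadicCube_eq_pi, closedBall_pi _ (by positivity)]
  simp only [Real.closedBall_eq_Icc]
  rw [Set.pi_univ_Icc]
  refine Measure.univ_pi_Ico_ae_eq_Icc.trans (Eq.eventuallyEq ?_)
  congr 1 <;> ext i <;> ring

/-- Lebesgue's density theorem along dyadic cubes. -/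
lemma ae_tendsto_dyadicDensity_one {B : Set (Fin n → ℝ)} (hB : NullMeasurableSet B) :
    ∀ᵐ x : Fin n → ℝ, x ∈ B →
      Tendsto (fun j => dyadicDensity B j (dyadicIndex j x)) atTop (𝓝 1) := by
  have h := IsUnifLocDoublingMeasure.ae_tendsto_measure_inter_div (volume : Measure (Fin n → ℝ)) B 1
  rw [ae_restrict_iff'₀ hB] at h
  filter_upwards [h] with x hx hxB
  have h1 := hx hxB (fun (j : ℕ) i => (dyadicIndex j x i + 1 / 2) / (2 : ℝ) ^ j)
    (fun j => ((2 : ℝ) ^ j)⁻¹ / 2) (l := atTop) ?_ ?_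
  · have h2 := (ENNReal.tendsto_toReal ENNReal.one_ne_top).comp h1
    rw [ENNReal.toReal_one] at h2
    refine h2.congr fun j => ?_
    have e := dyadicCube_ae_eq_closedBall j (dyadicIndex j x)
    simp only [Function.comp, dyadicDensity, measureReal_def]
    rw [ENNReal.toReal_div, measure_congr e, measure_congr ((ae_eq_refl B).inter e)]
  · refine tendsto_nhdsWithin_iff.2 ⟨?_, Eventually.of_forall fun j => ?_⟩
    · have := (tendsto_pow_atTop_nhds_zero_of_lt_one (r := (1 / 2 : ℝ)) (by norm_num)
        (by norm_num)).div_const 2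
      simpa using this
    · exact Set.mem_Ioi.2 (by positivity)
  · refine Eventually.of_forall fun j => ?_
    have hx' := subset_closure.trans (closure_dyadicCube_subset j _)
      (mem_dyadicCube_dyadicIndex j x)
    rw [one_mul, closedBall_pi _ (by positivity)]
    simp only [Real.closedBall_eq_Icc]
    rw [Set.pi_univ_Icc]
    convert hx' using 2 <;> ext i <;> ring

lemma ae_tendsto_dyadicDensity {B : Set (Fin n → ℝ)} (hB : NullMeasurableSet B) :
    ∀ᵐ x : Fin n → ℝ,
      (x ∉ B → Tendsto (fun j => dyadicDensity B j (dyadicIndex j x)) atTop (𝓝 0)) ∧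
      (x ∈ B → Tendsto (fun j => dyadicDensity B j (dyadicIndex j x)) atTop (𝓝 1)) := by
  filter_upwards [ae_tendsto_dyadicDensity_one hB, ae_tendsto_dyadicDensity_one hB.compl]
    with x h1 h2
  refine ⟨fun hx => ?_, h1⟩
  have h3 := (h2 hx).const_sub 1
  simpa [dyadicDensity_compl hB] using h3

/-! ### Paths of adjacent cubes -/

/-- Two distinct lattice points can be brought closer by a unit step. -/
lemma exists_unit_step {u v : Fin n → ℤ} (h : u ≠ v) :
    ∃ w i, (w = u + Pi.single i 1 ∨ u = w + Pi.single i 1) ∧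
      ∑ k, (w k - v k).natAbs + 1 = ∑ k, (u k - v k).natAbs ∧
      ∀ k, min (u k) (v k) ≤ w k ∧ w k ≤ max (u k) (v k) := by
  obtain ⟨i, hi⟩ := Function.ne_iff.1 h
  have hsum (w : Fin n → ℤ) (hw : ∀ k, k ≠ i → w k = u k)
      (hwi : (w i - v i).natAbs + 1 = (u i - v i).natAbs) :
      ∑ k, (w k - v k).natAbs + 1 = ∑ k, (u k - v k).natAbs := by
    rw [← Finset.add_sum_erase _ _ (Finset.mem_univ i),
      ← Finset.add_sum_erase _ (fun k => (u k - v k).natAbs) (Finset.mem_univ i), ← hwi,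
      Finset.sum_congr rfl fun k hk => by rw [hw k (Finset.ne_of_mem_erase hk)]]
    ring
  rcases lt_or_gt_of_ne hi with hlt | hlt
  · refine ⟨u + Pi.single i 1, i, Or.inl rfl, hsum _ (fun k hk => by simp [hk]) ?_, fun k => ?_⟩
    · simp only [Pi.add_apply, Pi.single_eq_same]
      omega
    · by_cases hk : k = i
      · subst hk
        simp only [Pi.add_apply, Pi.single_eq_same]
        omega
      · simp [hk]
  · refine ⟨u - Pi.single i 1, i, Or.inr (by simp), hsum _ (fun k hk => by simp [hk]) ?_,
      fun k => ?_⟩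
    · simp only [Pi.sub_apply, Pi.single_eq_same]
      omega
    · by_cases hk : k = i
      · subst hk
        simp only [Pi.sub_apply, Pi.single_eq_same]
        omega
      · simp [hk]

lemma abs_sub_le_of_unit_step {f : (Fin n → ℤ) → ℝ} {ε : ℝ}
    (hf : ∀ v i, |f (v + Pi.single i 1) - f v| ≤ ε) {u w : Fin n → ℤ} {i : Fin n}
    (h : w = u + Pi.single i 1 ∨ u = w + Pi.single i 1) : |f u - f w| ≤ ε := by
  rcases h with rfl | rfl
  · rw [abs_sub_comm]
    exact hf u i
  · exact hf w i

lemma abs_sub_le_mul_sum_natAbs {f : (Fin n → ℤ) → ℝ} {ε : ℝ}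
    (hf : ∀ v i, |f (v + Pi.single i 1) - f v| ≤ ε) (u v : Fin n → ℤ) :
    |f u - f v| ≤ (∑ k, (u k - v k).natAbs : ℕ) * ε := by
  induction hN : ∑ k, (u k - v k).natAbs generalizing u with
  | zero =>
    have : u = v := by
      ext k
      have := (Finset.sum_eq_zero_iff.1 hN) k (Finset.mem_univ k)
      omega
    simp [this]
  | succ N ih =>
    have huv : u ≠ v := by
      rintro rfl
      simp at hN
    obtain ⟨w, i, hw, hsum, -⟩ := exists_unit_step huv
    have h1 := ih w (by omega)
    have h2 := abs_sub_le_of_unit_step hf hw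
    have h3 := abs_sub_le (f u) (f w) (f v)
    push_cast
    linarith

lemma abs_sub_le_of_forall_abs_sub_le {f : (Fin n → ℤ) → ℝ} {ε : ℝ} (hε : 0 ≤ ε)
    (hf : ∀ v i, |f (v + Pi.single i 1) - f v| ≤ ε) {u v : Fin n → ℤ} {K : ℕ}
    (h : ∀ i, |u i - v i| ≤ K) : |f u - f v| ≤ n * K * ε := by
  refine (abs_sub_le_mul_sum_natAbs hf u v).trans ?_
  gcongr
  have : ∑ k, (u k - v k).natAbs ≤ ∑ _k : Fin n, K :=
    Finset.sum_le_sum fun k _ => by have := abs_le.1 (h k); omega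
  rw [Finset.sum_const, Finset.card_univ, Fintype.card_fin, smul_eq_mul] at this
  exact_mod_cast this

/-- A discrete intermediate value theorem on lattice boxes. -/
lemma exists_abs_sub_le_of_le_of_le {f : (Fin n → ℤ) → ℝ} {ε α : ℝ} (hε : 0 ≤ ε)
    (hf : ∀ v i, |f (v + Pi.single i 1) - f v| ≤ ε) {u v : Fin n → ℤ} (hu : α ≤ f u)
    (hv : f v ≤ α) :
    ∃ w, |f w - α| ≤ ε ∧ ∀ k, min (u k) (v k) ≤ w k ∧ w k ≤ max (u k) (v k) := by
  induction hN : ∑ k, (u k - v k).natAbs generalizing u with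
  | zero =>
    have : u = v := by
      ext k
      have := (Finset.sum_eq_zero_iff.1 hN) k (Finset.mem_univ k)
      omega
    subst this
    refine ⟨u, ?_, fun k => by simp⟩
    rw [le_antisymm hv hu, sub_self, abs_zero]
    exact hε
  | succ N ih =>
    have huv : u ≠ v := by
      rintro rfl
      simp at hN
    obtain ⟨w, i, hw, hsum, hbox⟩ := exists_unit_step huv
    rcases le_total α (f w) with h | h
    · obtain ⟨z, hz, hz'⟩ := ih h (by omega)
      refine ⟨z, hz, fun k => ?_⟩
      have := hz' k
      have := hbox k
      omega
    · refine ⟨w, ?_, hbox⟩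
      have := abs_le.1 (abs_sub_le_of_unit_step hf hw)
      rw [abs_le]
      constructor <;> linarith

lemma abs_sub_le_of_mem_children {j : ℕ} {X : ℕ → (Fin n → ℤ) → ℝ} (hX : IsDyadicMartingale X)
    {ε : ℝ} (hε : 0 ≤ ε) (hX' : ∀ v i, |X (j + 1) (v + Pi.single i 1) - X (j + 1) v| ≤ ε)
    {u v : Fin n → ℤ} (hu : u ∈ children v) : |X (j + 1) u - X j v| ≤ n * ε := by
  have h2 : (0 : ℝ) < 2 ^ n := by positivity
  have hd : ∀ w ∈ children v, |X (j + 1) u - X (j + 1) w| ≤ n * ε := by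
    intro w hw
    have := abs_sub_le_of_forall_abs_sub_le hε hX' (u := u) (v := w) (K := 1) fun i => by
      have h1 := Fintype.mem_piFinset.1 hu i
      have h2 := Fintype.mem_piFinset.1 hw i
      simp only [Finset.mem_insert, Finset.mem_singleton] at h1 h2
      rw [abs_le]
      push_cast
      omega
    simpa using this
  have h1 : 2 ^ n * (X (j + 1) u - X j v) = ∑ w ∈ children v, (X (j + 1) u - X (j + 1) w) := by
    rw [Finset.sum_sub_distrib, hX j v, Finset.sum_const, card_children, nsmul_eq_mul]
    push_cast
    ring
  have h3 : 2 ^ n * |X (j + 1) u - X j v| ≤ 2 ^ n * (n * ε) := by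
    rw [← abs_of_pos h2, ← abs_mul, abs_of_pos h2, h1]
    refine (Finset.abs_sum_le_sum_abs _ _).trans ((Finset.sum_le_sum hd).trans ?_)
    rw [Finset.sum_const, card_children, nsmul_eq_mul]
    push_cast
    rfl
  exact le_of_mul_le_mul_left h3 h2

/-- A uniformly bounded sequence of functions that tends to `0` uniformly has an antitone null
sequence of bounds. -/
lemma exists_antitone_bound {ι : Type*} {f : ℕ → ι → ℝ} {B : ℝ} (hB : ∀ j i, |f j i| ≤ B)
    (h : ∀ ε : ℝ, 0 < ε → ∃ J, ∀ j, J ≤ j → ∀ i, |f j i| ≤ ε) :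
    ∃ a : ℕ → ℝ, Antitone a ∧ Tendsto a atTop (𝓝 0) ∧ (∀ j, 0 ≤ a j) ∧ ∀ j i, |f j i| ≤ a j := by
  set T : ℕ → Set ℝ := fun j => {r | ∃ k, j ≤ k ∧ ∃ i, r = |f k i|} with hT
  have hbdd (j : ℕ) : BddAbove (T j) := ⟨B, by rintro _ ⟨k, _, i, rfl⟩; exact hB k i⟩
  have hnn (j : ℕ) : 0 ≤ sSup (T j) :=
    Real.sSup_nonneg (by rintro _ ⟨k, _, i, rfl⟩; exact abs_nonneg _)
  refine ⟨fun j => sSup (T j), fun j k hjk => ?_, ?_, hnn, fun j i => ?_⟩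
  · refine Real.sSup_le ?_ (hnn j)
    rintro _ ⟨l, hl, i, rfl⟩
    exact le_csSup (hbdd j) ⟨l, hjk.trans hl, i, rfl⟩
  · rw [Metric.tendsto_atTop]
    intro ε hε
    obtain ⟨J, hJ⟩ := h (ε / 2) (half_pos hε)
    refine ⟨J, fun j hj => ?_⟩
    rw [Real.dist_eq, sub_zero, abs_of_nonneg (hnn j)]
    refine lt_of_le_of_lt (Real.sSup_le ?_ (half_pos hε).le) (half_lt_self hε)
    rintro _ ⟨l, hl, i, rfl⟩
    exact hJ l (hj.trans hl) i
  · exact le_csSup (hbdd j) ⟨j, le_rfl, i, rfl⟩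

/-! ### From dyadic cubes to centered cubes -/

/-- Replacing a set by a union of dyadic cubes of nearly constant density changes its density by
at most the relative volume of the remainder. -/
lemma abs_volume_real_inter_sub_le (B : Set (Fin n → ℝ)) {Q : Set (Fin n → ℝ)}
    (hQ : volume Q ≠ ⊤) {j : ℕ} {V : Finset (Fin n → ℤ)} (hVQ : ∀ v ∈ V, dyadicCube j v ⊆ Q)
    {α e : ℝ} (hα0 : 0 ≤ α) (hα1 : α ≤ 1) (he : 0 ≤ e)
    (hV : ∀ v ∈ V, |dyadicDensity B j v - α| ≤ e) :
    |volume.real (B ∩ Q) - α * volume.real Q|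
      ≤ e * volume.real Q + (volume.real Q - V.card * ((2 : ℝ) ^ (n * j))⁻¹) := by
  set P := ⋃ v ∈ V, dyadicCube j v with hP
  have hPm : MeasurableSet P := V.measurableSet_biUnion fun v _ => measurableSet_dyadicCube j v
  have hPQ : P ⊆ Q := Set.iUnion₂_subset hVQ
  have hsum (E : Set (Fin n → ℝ)) :
      volume.real (E ∩ P) = ∑ v ∈ V, volume.real (E ∩ dyadicCube j v) := by
    have h (s : Set (Fin n → ℝ)) (hs : MeasurableSet s) :
        volume.real (E ∩ s) = (volume.restrict E).real s := by
      rw [measureReal_restrict_apply hs, Set.inter_comm]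
    rw [h P hPm, hP, measureReal_biUnion_finset (fun u _ w _ huw => disjoint_dyadicCube huw)
      (fun v _ => measurableSet_dyadicCube j v) fun v _ => ?_]
    · exact Finset.sum_congr rfl fun v _ => (h _ (measurableSet_dyadicCube j v)).symm
    · exact ne_top_of_le_ne_top (volume_dyadicCube_ne_top j v) (Measure.restrict_apply_le _ _)
  have hPvol : volume.real P = V.card * ((2 : ℝ) ^ (n * j))⁻¹ := by
    have := hsum Set.univ
    simp only [Set.univ_inter, volume_real_dyadicCube, Finset.sum_const, nsmul_eq_mul] at this
    exact this
  have h1 : |volume.real (B ∩ P) - α * volume.real P| ≤ e * volume.real P := by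
    rw [hsum, ← Set.univ_inter P, hsum, Finset.mul_sum, Finset.mul_sum, ← Finset.sum_sub_distrib]
    refine (Finset.abs_sum_le_sum_abs _ _).trans (Finset.sum_le_sum fun v hv => ?_)
    rw [Set.univ_inter, ← dyadicDensity_mul, ← sub_mul, abs_mul,
      abs_of_pos (volume_real_dyadicCube_pos j v)]
    exact mul_le_mul_of_nonneg_right (hV v hv) measureReal_nonneg
  have hBQ := measureReal_inter_add_sdiff (μ := volume) (s := B ∩ Q) hPm
    (ne_top_of_le_ne_top hQ (measure_mono Set.inter_subset_right))
  have hQQ := measureReal_inter_add_sdiff (μ := volume) (s := Q) hPm hQ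
  rw [Set.inter_assoc, Set.inter_eq_right.2 hPQ] at hBQ
  rw [Set.inter_eq_right.2 hPQ] at hQQ
  have h2 : volume.real ((B ∩ Q) \ P) ≤ volume.real (Q \ P) :=
    measureReal_mono (Set.sdiff_subset_sdiff_left Set.inter_subset_right)
      (ne_top_of_le_ne_top hQ (measure_mono Set.sdiff_subset))
  have h3 : 0 ≤ volume.real ((B ∩ Q) \ P) := measureReal_nonneg
  have h4 : 0 ≤ volume.real P := measureReal_nonneg
  rw [← hPvol]
  rw [abs_le] at h1 ⊢
  constructor <;> nlinarith

/-- The cubes centered at `x` inherit the limit of the densities of the dyadic cubes containing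
`x`: a centered cube of side `h` is filled, up to a small proportion, by dyadic cubes of side
about `2 ^ (-s) * h`. -/
lemma tendsto_density_closedBall {B : Set (Fin n → ℝ)} {a : ℕ → ℝ} (ha : Tendsto a atTop (𝓝 0))
    (ha0 : ∀ j, 0 ≤ a j)
    (hB : ∀ j v i, |dyadicDensity B j (v + Pi.single i 1) - dyadicDensity B j v| ≤ a j)
    {α : ℝ} (hα0 : 0 ≤ α) (hα1 : α ≤ 1) {x : Fin n → ℝ}
    (hx : Tendsto (fun j => dyadicDensity B j (dyadicIndex j x)) atTop (𝓝 α)) :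
    Tendsto (fun h : ℝ => volume.real (B ∩ Metric.closedBall x (h / 2)) /
      volume.real (Metric.closedBall x (h / 2))) (𝓝[>] 0) (𝓝 α) := by
  rw [Metric.tendsto_nhds]
  intro ε hε
  obtain ⟨s, hs2, hs⟩ : ∃ s : ℕ, 2 ≤ s ∧ 1 - (1 - 4 * (1 / 2 : ℝ) ^ s) ^ n < ε / 2 := by
    have h1 : Tendsto (fun s : ℕ => 1 - (1 - 4 * (1 / 2 : ℝ) ^ s) ^ n) atTop (𝓝 0) := by
      have := ((((tendsto_pow_atTop_nhds_zero_of_lt_one (r := (1 / 2 : ℝ)) (by norm_num)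
        (by norm_num)).const_mul 4).const_sub 1).pow n).const_sub 1
      simpa using this
    obtain ⟨s, hs, hs'⟩ := ((h1.eventually_lt_const (half_pos hε)).and
      (eventually_ge_atTop 2)).exists
    exact ⟨s, hs', hs⟩
  have hlim : Tendsto (fun j => |dyadicDensity B j (dyadicIndex j x) - α|
      + n * (2 ^ s : ℕ) * a j) atTop (𝓝 0) := by
    have := (hx.sub_const α).abs.add (ha.const_mul ((n : ℝ) * (2 ^ s : ℕ)))
    simpa using this
  obtain ⟨J, hJ⟩ := eventually_atTop.1 (hlim.eventually_lt_const (half_pos hε))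
  have hsmall : ∀ᶠ h : ℝ in 𝓝[>] 0, h < (1 / 2) ^ J :=
    (eventually_lt_nhds (by positivity)).filter_mono nhdsWithin_le_nhds
  filter_upwards [hsmall, self_mem_nhdsWithin] with h hhJ hh0
  rw [Set.mem_Ioi] at hh0
  have hh1 : h ≤ 1 := hhJ.le.trans (pow_le_one₀ (by norm_num) (by norm_num))
  obtain ⟨k, hk1, hk2⟩ := exists_nat_pow_near (one_le_inv_iff₀.2 ⟨hh0, hh1⟩) one_lt_two
  have hk1' : h * 2 ^ k ≤ 1 := by
    have := mul_le_mul_of_nonneg_left hk1 hh0.le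
    rwa [mul_inv_cancel₀ hh0.ne'] at this
  have hk2' : 1 < h * 2 ^ (k + 1) := by
    have := mul_lt_mul_of_pos_left hk2 hh0
    rwa [mul_inv_cancel₀ hh0.ne'] at this
  have hJk : J ≤ k := by
    by_contra! hlt
    have h1 : (2 : ℝ) ^ (k + 1) ≤ 2 ^ J := pow_le_pow_right₀ one_le_two hlt
    have h2 : h * 2 ^ J < 1 := by
      calc h * 2 ^ J < (1 / 2) ^ J * 2 ^ J := by gcongr
        _ = 1 := by rw [← mul_pow]; norm_num
    nlinarith
  set j := k + s with hj
  have hJ' := hJ j (by omega)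
  set H := h * 2 ^ j with hH
  have hHs : H ≤ 2 ^ s := by
    rw [hH, hj, pow_add, ← mul_assoc]
    exact mul_le_of_le_one_left (by positivity) hk1'
  have hHs' : 2 ^ s < 2 * H := by
    have : 2 * H = h * 2 ^ (k + 1) * 2 ^ s := by
      rw [hH, hj]
      ring
    rw [this]
    exact lt_mul_of_one_lt_left (by positivity) hk2'
  have hs4 : (4 : ℝ) ≤ 2 ^ s := by
    calc (4 : ℝ) = 2 ^ 2 := by norm_num
      _ ≤ _ := pow_le_pow_right₀ one_le_two hs2
  have hjpos : (0 : ℝ) < 2 ^ j := by positivity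
  -- the dyadic cubes contained in the centered cube
  set V : Finset (Fin n → ℤ) := Fintype.piFinset fun i =>
    Finset.Ico ⌈x i * 2 ^ j - H / 2⌉ ⌊x i * 2 ^ j + H / 2⌋ with hV
  have hVmem : ∀ v ∈ V, ∀ i, x i * 2 ^ j - H / 2 ≤ v i ∧ (v i : ℝ) + 1 ≤ x i * 2 ^ j + H / 2 := by
    intro v hv i
    have h1 := Finset.mem_Ico.1 (Fintype.mem_piFinset.1 hv i)
    have h2 := Int.le_floor.1 (Int.add_one_le_of_lt h1.2)
    push_cast at h2
    exact ⟨Int.ceil_le.1 h1.1, h2⟩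
  have hVQ : ∀ v ∈ V, dyadicCube j v ⊆ Metric.closedBall x (h / 2) := by
    intro v hv y hy
    rw [Metric.mem_closedBall, dist_pi_le_iff (by positivity)]
    intro i
    have h1 := hVmem v hv i
    have h2 := mem_dyadicCube_iff.1 hy i
    rw [Real.dist_eq]
    refine le_of_mul_le_mul_right ?_ hjpos
    rw [← abs_of_pos hjpos, ← abs_mul, abs_of_pos hjpos, sub_mul, abs_le, div_mul_eq_mul_div, ← hH]
    constructor <;> linarith
  have hVD : ∀ v ∈ V, |dyadicDensity B j v - α|
      ≤ |dyadicDensity B j (dyadicIndex j x) - α| + n * (2 ^ s : ℕ) * a j := by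
    intro v hv
    have h1 := abs_sub_le_of_forall_abs_sub_le (ha0 j) (hB j) (u := v) (v := dyadicIndex j x)
      (K := 2 ^ s) fun i => by
        have h1 := hVmem v hv i
        have h2 := Int.floor_le (x i * (2 : ℝ) ^ j)
        have h3 := Int.lt_floor_add_one (x i * (2 : ℝ) ^ j)
        have : |(v i : ℝ) - ⌊x i * (2 : ℝ) ^ j⌋| ≤ 2 ^ s := by
          rw [abs_le]
          constructor <;> linarith
        rw [← Int.cast_le (R := ℝ)]
        push_cast
        exact this
    have h2 := abs_sub_le (dyadicDensity B j v) (dyadicDensity B j (dyadicIndex j x)) α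
    linarith
  have hcard : (H - 2) ^ n ≤ V.card := by
    rw [hV, Fintype.card_piFinset]
    push_cast
    have : (H - 2) ^ n = ∏ _i : Fin n, (H - 2) := by simp
    rw [this]
    refine Finset.prod_le_prod (fun i _ => by linarith) fun i _ => ?_
    rw [Int.card_Ico]
    have h1 := Int.lt_floor_add_one (x i * 2 ^ j + H / 2)
    have h2 := Int.ceil_lt_add_one (x i * 2 ^ j - H / 2)
    have h3 : ((⌊x i * 2 ^ j + H / 2⌋ - ⌈x i * 2 ^ j - H / 2⌉ : ℤ) : ℝ)
        ≤ ((⌊x i * 2 ^ j + H / 2⌋ - ⌈x i * 2 ^ j - H / 2⌉).toNat : ℝ) := by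
      exact_mod_cast Int.self_le_toNat _
    push_cast at h3
    linarith
  have hvol : volume.real (Metric.closedBall x (h / 2)) = h ^ n := by
    rw [measureReal_def, Real.volume_pi_closedBall _ (by positivity),
      ENNReal.toReal_ofReal (by positivity)]
    simp [mul_div_cancel₀]
  have hQtop : volume (Metric.closedBall x (h / 2)) ≠ ⊤ := measure_closedBall_lt_top.ne
  have key := abs_volume_real_inter_sub_le B hQtop hVQ hα0 hα1
    (add_nonneg (abs_nonneg _) (mul_nonneg (by positivity) (ha0 j))) hVD
  have hhn : 0 < h ^ n := by positivity
  rw [hvol] at key ⊢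
  have hrem : h ^ n - V.card * ((2 : ℝ) ^ (n * j))⁻¹
      ≤ (1 - (1 - 4 * (1 / 2 : ℝ) ^ s) ^ n) * h ^ n := by
    have h1 : (1 - 4 * (1 / 2 : ℝ) ^ s) * H ≤ H - 2 := by
      have : (1 / 2 : ℝ) ^ s * 2 ^ s = 1 := by rw [← mul_pow]; norm_num
      nlinarith [pow_pos (one_half_pos (α := ℝ)) s]
    have h0 : 0 ≤ 1 - 4 * (1 / 2 : ℝ) ^ s := by
      have : (1 / 2 : ℝ) ^ s ≤ (1 / 2) ^ 2 :=
        pow_le_pow_of_le_one (by norm_num) (by norm_num) hs2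
      norm_num at this ⊢
      linarith
    have h2 : ((1 - 4 * (1 / 2 : ℝ) ^ s) * H) ^ n ≤ V.card :=
      (pow_le_pow_left₀ (mul_nonneg h0 (by positivity)) h1 n).trans hcard
    have h3 : (1 - 4 * (1 / 2 : ℝ) ^ s) ^ n * h ^ n ≤ V.card * ((2 : ℝ) ^ (n * j))⁻¹ := by
      rw [← div_eq_mul_inv, le_div_iff₀ (by positivity), mul_assoc, pow_mul', ← mul_pow, ← mul_pow]
      exact h2
    linarith
  rw [Real.dist_eq]
  have e1 : volume.real (B ∩ Metric.closedBall x (h / 2)) / h ^ n - α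
      = (volume.real (B ∩ Metric.closedBall x (h / 2)) - α * h ^ n) / h ^ n := by
    field_simp
  rw [e1, abs_div, abs_of_pos hhn, div_lt_iff₀ hhn]
  nlinarith

/-- A point at which the density is neither `0` nor `1` is a boundary point. -/
lemma mem_frontier_of_tendsto_density {B : Set (Fin n → ℝ)} {α : ℝ} (hα0 : α ≠ 0) (hα1 : α ≠ 1)
    {x : Fin n → ℝ}
    (hx : Tendsto (fun h : ℝ => volume.real (B ∩ Metric.closedBall x (h / 2)) /
      volume.real (Metric.closedBall x (h / 2))) (𝓝[>] 0) (𝓝 α)) : x ∈ frontier B := by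
  have hnear (U : Set (Fin n → ℝ)) (hU : U ∈ 𝓝 x) :
      ∀ᶠ h : ℝ in 𝓝[>] 0, 0 < h ∧ Metric.closedBall x (h / 2) ⊆ U := by
    obtain ⟨r, hr, hrU⟩ := Metric.nhds_basis_closedBall.mem_iff.1 hU
    have : ∀ᶠ h : ℝ in 𝓝[>] 0, h < r :=
      (eventually_lt_nhds hr).filter_mono nhdsWithin_le_nhds
    filter_upwards [this, self_mem_nhdsWithin] with h h1 h2
    rw [Set.mem_Ioi] at h2
    exact ⟨h2, (Metric.closedBall_subset_closedBall (by linarith)).trans hrU⟩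
  refine ⟨?_, fun hint => hα1 ?_⟩
  · by_contra hcl
    refine hα0 (tendsto_nhds_unique hx (tendsto_const_nhds.congr' ?_))
    filter_upwards [hnear Bᶜ (mem_interior_iff_mem_nhds.1 (by rwa [interior_compl]))] with h hh
    rw [(Set.disjoint_left.2 fun y hy hy' => hh.2 hy' hy : Disjoint B _).inter_eq]
    simp
  · refine tendsto_nhds_unique hx (tendsto_const_nhds.congr' ?_)
    filter_upwards [hnear B (mem_interior_iff_mem_nhds.1 hint)] with h hh
    rw [Set.inter_eq_right.2 hh.2, div_self]
    exact (ENNReal.toReal_pos (Metric.measure_closedBall_pos _ _ (half_pos hh.1)).ne'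
      measure_closedBall_lt_top.ne).ne'

/-! ### Smooth sets in coordinates -/

/-- The dyadic form of the theorem: if the densities of adjacent dyadic cubes are uniformly close
and a box contains points of density `1` and of density `0`, then it contains a small dyadic cube
of density about `α`. -/
lemma le_dimH_inter_box {B : Set (Fin n → ℝ)} (hB : NullMeasurableSet B)
    (hsmooth : ∀ ε : ℝ, 0 < ε → ∃ J, ∀ j, J ≤ j → ∀ v i,
      |dyadicDensity B j (v + Pi.single i 1) - dyadicDensity B j v| ≤ ε)
    {lo hi : Fin n → ℝ} (hin : volume (B ∩ Set.univ.pi fun i => Set.Ioo (lo i) (hi i)) ≠ 0)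
    (hout : volume (Bᶜ ∩ Set.univ.pi fun i => Set.Ioo (lo i) (hi i)) ≠ 0)
    {α : ℝ} (hα0 : 0 < α) (hα1 : α < 1) {d : NNReal} (hd : 0 < d) (hdn : (d : ℝ) < n) :
    (d : ENNReal) ≤ dimH ({x | Tendsto (fun h : ℝ =>
      volume.real (B ∩ Metric.closedBall x (h / 2)) / volume.real (Metric.closedBall x (h / 2)))
        (𝓝[>] 0) (𝓝 α)} ∩ Set.univ.pi fun i => Set.Ioo (lo i) (hi i)) := by
  set O := Set.univ.pi fun i => Set.Ioo (lo i) (hi i) with hO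
  obtain ⟨a, haanti, halim, ha0, ha⟩ := exists_antitone_bound
    (f := fun j (p : (Fin n → ℤ) × Fin n) =>
      dyadicDensity B j (p.1 + Pi.single p.2 1) - dyadicDensity B j p.1) (B := 1)
    (fun j p => by
      rw [abs_le]
      constructor <;> linarith [dyadicDensity_nonneg B j p.1, dyadicDensity_le_one B j p.1,
        dyadicDensity_nonneg B j (p.1 + Pi.single p.2 1),
        dyadicDensity_le_one B j (p.1 + Pi.single p.2 1)])
    (fun ε hε => by
      obtain ⟨J, hJ⟩ := hsmooth ε hε
      exact ⟨J, fun j hj p => hJ j hj p.1 p.2⟩)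
  replace ha : ∀ j v i, |dyadicDensity B j (v + Pi.single i 1) - dyadicDensity B j v| ≤ a j :=
    fun j v i => ha j (v, i)
  -- the summand `1 / (j + 1)` makes the bounds positive
  set ω : ℕ → ℝ := fun j => n * a j + a j + 1 / ((j : ℝ) + 1) with hωdef
  have hω : Antitone ω := by
    intro j k hjk
    have := haanti hjk
    have h2 : (j : ℝ) ≤ k := by exact_mod_cast hjk
    simp only [hωdef]
    gcongr
  have hω0 (j : ℕ) : 0 < ω j := by
    have := ha0 j
    simp only [hωdef]
    positivity
  have hωlim : Tendsto ω atTop (𝓝 0) := by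
    have := ((halim.const_mul (n : ℝ)).add halim).add
      (tendsto_one_div_add_atTop_nhds_zero_nat (𝕜 := ℝ))
    simpa [hωdef] using this
  have hnaω (j : ℕ) : n * a j ≤ ω j := by
    have := ha0 j
    simp only [hωdef]
    have : 0 ≤ 1 / ((j : ℝ) + 1) := by positivity
    linarith
  have haω (j : ℕ) : a j ≤ ω j := by
    have := mul_nonneg (Nat.cast_nonneg (α := ℝ) n) (ha0 j)
    simp only [hωdef]
    have : 0 ≤ 1 / ((j : ℝ) + 1) := by positivity
    linarith
  have hD := isDyadicMartingale_dyadicDensity B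
  obtain ⟨m₀, hm₀⟩ := exists_le_dimH_tendsto hω hω0 hωlim hD
    (fun j v u hu => (abs_sub_le_of_mem_children hD (ha0 _) (ha _) hu).trans (hnaω _))
    (fun j u v huv => by
      have := abs_sub_le_of_forall_abs_sub_le (ha0 j) (ha j) (u := u) (v := v) (K := 1)
        (by simpa using huv)
      rw [Nat.cast_one, mul_one] at this
      exact this.trans (hnaω j))
    (by
      filter_upwards [ae_tendsto_dyadicDensity hB] with x hx
      by_cases h : x ∈ B
      · exact Or.inr (hx.2 h)
      · exact Or.inl (hx.1 h)) hα0 hα1 hd hdn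
  obtain ⟨x, ⟨hxB, hxO⟩, hx⟩ := ((frequently_ae_mem_iff.2 hin).and_eventually
    (ae_tendsto_dyadicDensity hB)).exists
  obtain ⟨y, ⟨hyB, hyO⟩, hy⟩ := ((frequently_ae_mem_iff.2 hout).and_eventually
    (ae_tendsto_dyadicDensity hB)).exists
  have hbox (z : Fin n → ℝ) (hz : z ∈ O) :
      ∀ᶠ j : ℕ in atTop, ∀ i, lo i < z i - (1 / 2 : ℝ) ^ j ∧ z i + (1 / 2 : ℝ) ^ j < hi i := by
    have h0 := tendsto_pow_atTop_nhds_zero_of_lt_one (r := (1 / 2 : ℝ)) (by norm_num)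
      (by norm_num)
    refine eventually_all.2 fun i => ?_
    have hzi := hz i (Set.mem_univ i)
    refine ((h0.const_sub (z i)).eventually_const_lt (by simpa using hzi.1)).and
      ((h0.const_add (z i)).eventually_lt_const (by simpa using hzi.2))
  obtain ⟨m, hmx, hmy, hbx, hby, hm⟩ := (((hx.2 hxB).eventually_const_lt hα1).and
    (((hy.1 hyB).eventually_lt_const hα0).and ((hbox x hxO).and ((hbox y hyO).and
      (eventually_ge_atTop m₀))))).exists
  obtain ⟨w, hw, hwbox⟩ := exists_abs_sub_le_of_le_of_le (ha0 m) (ha m) hmx.le hmy.le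
  refine (hm₀ m hm w (hw.trans (haω m))).trans (dimH_mono fun z hz => ⟨?_, fun i _ => ?_⟩)
  · exact tendsto_density_closedBall halim ha0 ha hα0.le hα1.le hz.2
  · have hz1 := (closure_dyadicCube_subset m w hz.1).1 i
    have hz2 := (closure_dyadicCube_subset m w hz.1).2 i
    simp only at hz1 hz2
    rw [div_le_iff₀ (by positivity)] at hz1
    rw [le_div_iff₀ (by positivity)] at hz2
    have hpow : (1 / 2 : ℝ) ^ m * 2 ^ m = 1 := by rw [← mul_pow]; norm_num
    have hpos : (0 : ℝ) < 2 ^ m := by positivity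
    have fx1 := Int.floor_le (x i * (2 : ℝ) ^ m)
    have fx2 := Int.lt_floor_add_one (x i * (2 : ℝ) ^ m)
    have fy1 := Int.floor_le (y i * (2 : ℝ) ^ m)
    have fy2 := Int.lt_floor_add_one (y i * (2 : ℝ) ^ m)
    have hwi := hwbox i
    simp only [dyadicIndex, min_le_iff, le_max_iff] at hwi
    have bx := hbx i
    have by' := hby i
    constructor
    · refine lt_of_mul_lt_mul_right ?_ hpos.le
      rcases hwi.1 with h | h
      · have h' : (⌊x i * (2 : ℝ) ^ m⌋ : ℝ) ≤ w i := by exact_mod_cast h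
        nlinarith
      · have h' : (⌊y i * (2 : ℝ) ^ m⌋ : ℝ) ≤ w i := by exact_mod_cast h
        nlinarith
    · refine lt_of_mul_lt_mul_right ?_ hpos.le
      rcases hwi.2 with h | h
      · have h' : (w i : ℝ) ≤ ⌊x i * (2 : ℝ) ^ m⌋ := by exact_mod_cast h
        nlinarith
      · have h' : (w i : ℝ) ≤ ⌊y i * (2 : ℝ) ^ m⌋ := by exact_mod_cast h
        nlinarith

/-! ### Transfer to Euclidean space -/

lemma volume_preimage_toLp (S : Set (EuclideanSpace ℝ (Fin n))) :
    volume (WithLp.toLp 2 ⁻¹' S : Set (Fin n → ℝ)) = volume S :=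
  (PiLp.volume_preserving_toLp (Fin n)).measure_preimage_emb
    (MeasurableEquiv.toLp 2 (Fin n → ℝ)).measurableEmbedding S

lemma density_eq_preimage (A Q : Set (EuclideanSpace ℝ (Fin n))) :
    density A Q = volume.real ((WithLp.toLp 2 ⁻¹' A : Set (Fin n → ℝ)) ∩ WithLp.toLp 2 ⁻¹' Q) /
      volume.real (WithLp.toLp 2 ⁻¹' Q : Set (Fin n → ℝ)) := by
  rw [density, measureReal_def, measureReal_def, ← Set.preimage_inter, volume_preimage_toLp,
    volume_preimage_toLp]

lemma preimage_centeredCube (x : Fin n → ℝ) {h : ℝ} (hh : 0 ≤ h) :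
    (WithLp.toLp 2 ⁻¹' centeredCube (WithLp.toLp 2 x) h : Set (Fin n → ℝ))
      = Metric.closedBall x (h / 2) := by
  ext y
  simp [centeredCube, dist_pi_le_iff (div_nonneg hh zero_le_two), Real.dist_eq]

lemma preimage_densitySet (A : Set (EuclideanSpace ℝ (Fin n))) (α : ℝ) :
    (WithLp.toLp 2 ⁻¹' densitySet A α : Set (Fin n → ℝ)) = {x | Tendsto (fun h : ℝ =>
      volume.real ((WithLp.toLp 2 ⁻¹' A : Set (Fin n → ℝ)) ∩ Metric.closedBall x (h / 2)) /
        volume.real (Metric.closedBall x (h / 2))) (𝓝[>] 0) (𝓝 α)} := by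
  ext x
  refine tendsto_congr' ?_
  filter_upwards [self_mem_nhdsWithin] with h hh
  rw [density_eq_preimage, preimage_centeredCube x (le_of_lt hh)]

lemma dimH_preimage_toLp (S : Set (EuclideanSpace ℝ (Fin n))) :
    dimH (WithLp.toLp 2 ⁻¹' S : Set (Fin n → ℝ)) = dimH S :=
  (PiLp.continuousLinearEquiv 2 ℝ fun _ : Fin n => ℝ).symm.dimH_preimage S

lemma densitySet_subset_frontier (A : Set (EuclideanSpace ℝ (Fin n))) {α : ℝ} (hα0 : α ≠ 0)
    (hα1 : α ≠ 1) : densitySet A α ⊆ frontier A := by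
  intro x hx
  have h1 : WithLp.ofLp x ∈ (WithLp.toLp 2 ⁻¹' densitySet A α : Set (Fin n → ℝ)) := hx
  rw [preimage_densitySet] at h1
  have h2 := mem_frontier_of_tendsto_density hα0 hα1 h1
  have h3 := (PiLp.homeomorph 2 fun _ : Fin n => ℝ).symm.preimage_frontier A
  exact (Set.ext_iff.1 h3 (WithLp.ofLp x)).2 h2

lemma isCubeAt_preimage_dyadicCube (j : ℕ) (v : Fin n → ℤ) :
    IsCubeAt (WithLp.toLp 2 fun i => v i / (2 : ℝ) ^ j) ((2 : ℝ) ^ j)⁻¹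
      (WithLp.ofLp ⁻¹' dyadicCube j v) := by
  refine ⟨by positivity, fun i => Set.Ico (v i / (2 : ℝ) ^ j) ((v i + 1) / (2 : ℝ) ^ j),
    fun i => ?_, ?_⟩
  · have : (v i : ℝ) / 2 ^ j + ((2 : ℝ) ^ j)⁻¹ = (v i + 1) / 2 ^ j := by ring
    simp only [this]
    exact ⟨Set.Ioo_subset_Ico_self, Set.Ico_subset_Icc_self⟩
  · ext x
    simp [dyadicCube_eq_pi]

lemma closure_preimage_dyadicCube (j : ℕ) (v : Fin n → ℤ) :
    closure (WithLp.ofLp ⁻¹' dyadicCube j v : Set (EuclideanSpace ℝ (Fin n)))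
      = closedCube (WithLp.toLp 2 fun i => v i / (2 : ℝ) ^ j) ((2 : ℝ) ^ j)⁻¹ := by
  have h := (PiLp.homeomorph 2 fun _ : Fin n => ℝ).preimage_closure (dyadicCube j v)
  refine h.symm.trans ?_
  rw [dyadicCube_eq_pi, closure_pi_set]
  have hlt (i : Fin n) : (v i : ℝ) / 2 ^ j ≠ (v i + 1) / 2 ^ j := by
    rw [add_div]
    have : (0 : ℝ) < 1 / 2 ^ j := by positivity
    linarith
  have hside (i : Fin n) : (v i : ℝ) / 2 ^ j + ((2 : ℝ) ^ j)⁻¹ = (v i + 1) / 2 ^ j := by ring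
  ext x
  simp only [closure_Ico (hlt _), closedCube, hside]
  simp only [Set.pi_univ_Icc, Set.mem_preimage, Set.mem_Icc]
  exact ⟨fun h i => ⟨h.1 i, h.2 i⟩, fun h => ⟨fun i => (h i).1, fun i => (h i).2⟩⟩

lemma closedCube_inter_eq_face {c c' : EuclideanSpace ℝ (Fin n)} {l : ℝ} (hl : 0 ≤ l) {i : Fin n}
    (hi : c' i = c i + l) (hne : ∀ k, k ≠ i → c' k = c k) :
    closedCube c' l ∩ closedCube c l = {x ∈ closedCube c' l | x i = c' i} ∧
      closedCube c' l ∩ closedCube c l = {x ∈ closedCube c l | x i = c i + l} := by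
  have hface (x : EuclideanSpace ℝ (Fin n)) (hx : x i = c i + l) :
      x ∈ closedCube c' l ↔ x ∈ closedCube c l := by
    refine forall_congr' fun k => ?_
    by_cases hk : k = i
    · subst hk
      rw [hx, hi]
      constructor <;> intro _ <;> constructor <;> linarith
    · rw [hne k hk]
  constructor
  · ext x
    refine ⟨fun hx => ⟨hx.1, ?_⟩, fun hx => ⟨hx.1, (hface x (hx.2.trans hi)).1 hx.1⟩⟩
    linarith [(hx.1 i).1, (hx.2 i).2]
  · ext x
    refine ⟨fun hx => ⟨hx.2, ?_⟩, fun hx => ⟨(hface x hx.2).2 hx.1, hx.1⟩⟩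
    linarith [(hx.1 i).1, (hx.2 i).2]

lemma consecutive_dyadicCube (j : ℕ) (v : Fin n → ℤ) (i : Fin n) :
    Consecutive ((2 : ℝ) ^ j)⁻¹
      (WithLp.ofLp ⁻¹' dyadicCube j (v + Pi.single i 1) : Set (EuclideanSpace ℝ (Fin n)))
      (WithLp.ofLp ⁻¹' dyadicCube j v) := by
  have h := closedCube_inter_eq_face (c := WithLp.toLp 2 fun k => v k / (2 : ℝ) ^ j)
    (c' := WithLp.toLp 2 fun k => ((v + Pi.single i 1 : Fin n → ℤ) k) / (2 : ℝ) ^ j)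
    (l := ((2 : ℝ) ^ j)⁻¹) (i := i) (by positivity) (by simp [add_div])
    (fun k hk => by simp [Pi.single_eq_of_ne hk])
  refine ⟨_, _, isCubeAt_preimage_dyadicCube j _, isCubeAt_preimage_dyadicCube j v, ?_, ?_⟩ <;>
    rw [closure_preimage_dyadicCube, closure_preimage_dyadicCube]
  · exact ⟨i, Or.inl h.1⟩
  · exact ⟨i, Or.inr h.2⟩

/-- Smoothness bounds the differences of the densities of adjacent dyadic cubes. -/
lemma IsSmooth.exists_forall_dyadicDensity_sub_le {A : Set (EuclideanSpace ℝ (Fin n))}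
    (hA : IsSmooth A) {ε : ℝ} (hε : 0 < ε) :
    ∃ J, ∀ j, J ≤ j → ∀ v i, |dyadicDensity (WithLp.toLp 2 ⁻¹' A) j (v + Pi.single i 1)
      - dyadicDensity (WithLp.toLp 2 ⁻¹' A : Set (Fin n → ℝ)) j v| ≤ ε := by
  obtain ⟨δ, hδ, h⟩ := hA.2 ε hε
  obtain ⟨J, hJ⟩ := exists_pow_lt_of_lt_one hδ (one_half_lt_one (α := ℝ))
  refine ⟨J, fun j hj v i => ?_⟩
  have hl : ((2 : ℝ) ^ j)⁻¹ ≤ δ := by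
    rw [← inv_pow, ← one_div]
    exact (pow_le_pow_of_le_one (by norm_num) (by norm_num) hj).trans hJ.le
  have := h _ _ _ hl (consecutive_dyadicCube j v i)
  rwa [density_eq_preimage, density_eq_preimage] at this

/-- The lower bound for the dimension inside a cube in which `A` is neither null nor of full
measure. -/
lemma IsSmooth.le_dimH_densitySet_inter {A : Set (EuclideanSpace ℝ (Fin n))} (hA : IsSmooth A)
    {Q : Set (EuclideanSpace ℝ (Fin n))} (hQ : IsCube Q) (hpos : 0 < volume (A ∩ Q))
    (hlt : volume (A ∩ Q) < volume Q) {α : ℝ} (hα0 : 0 < α) (hα1 : α < 1) :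
    (n : ENNReal) ≤ dimH (densitySet A α ∩ Q) := by
  obtain ⟨c, l, hl, I, hI, rfl⟩ := hQ
  set Q : Set (EuclideanSpace ℝ (Fin n)) := {x | ∀ i, x i ∈ I i} with hQdef
  set O : Set (Fin n → ℝ) := Set.univ.pi fun i => Set.Ioo (c i) (c i + l) with hO
  set B : Set (Fin n → ℝ) := WithLp.toLp 2 ⁻¹' A with hBdef
  have hOQ : O ⊆ WithLp.toLp 2 ⁻¹' Q := fun x hx i => (hI i).1 (hx i (Set.mem_univ i))
  have hQO : (WithLp.toLp 2 ⁻¹' Q : Set (Fin n → ℝ)) ≤ᵐ[volume] O := by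
    have h1 : (WithLp.toLp 2 ⁻¹' Q : Set (Fin n → ℝ)) ⊆ Set.Icc c.ofLp fun i => c i + l :=
      fun x hx => ⟨fun i => ((hI i).2 (hx i)).1, fun i => ((hI i).2 (hx i)).2⟩
    exact h1.eventuallyLE.trans Measure.univ_pi_Ioo_ae_eq_Icc.symm.le
  have hB : NullMeasurableSet B :=
    hA.1.preimage (PiLp.volume_preserving_toLp (Fin n)).quasiMeasurePreserving
  have hin : volume (B ∩ O) ≠ 0 := by
    refine (hpos.trans_le ?_).ne'
    rw [← volume_preimage_toLp]
    exact measure_mono_ae ((EventuallyLE.refl (ae volume) B).inter hQO)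
  have hout : volume (Bᶜ ∩ O) ≠ 0 := by
    intro h0
    have h1 : volume (Aᶜ ∩ Q) = 0 := by
      rw [← volume_preimage_toLp]
      exact le_antisymm ((measure_mono_ae ((EventuallyLE.refl (ae volume) Bᶜ).inter hQO)).trans h0.le) zero_le
    refine hlt.not_ge ?_
    calc volume Q ≤ volume (A ∩ Q) + volume (Aᶜ ∩ Q) := by
          refine (measure_mono fun x hx => ?_).trans (measure_union_le _ _)
          by_cases h : x ∈ A
          · exact Or.inl ⟨h, hx⟩
          · exact Or.inr ⟨h, hx⟩
      _ = volume (A ∩ Q) := by rw [h1, add_zero]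
  refine ENNReal.le_of_forall_nnreal_lt fun d hd => ?_
  rcases eq_or_ne d 0 with rfl | hd0
  · simp
  · have hd' : (d : ℝ) < n := by exact_mod_cast hd
    rw [← dimH_preimage_toLp, Set.preimage_inter, preimage_densitySet]
    exact (le_dimH_inter_box hB (fun ε hε => hA.exists_forall_dyadicDensity_sub_le hε) hin hout
      hα0 hα1 (pos_iff_ne_zero.2 hd0) hd').trans
        (dimH_mono (Set.inter_subset_inter_right _ hOQ))

lemma dimH_le_natCast (S : Set (EuclideanSpace ℝ (Fin n))) : dimH S ≤ n := by
  refine (dimH_mono (Set.subset_univ S)).trans_eq ?_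
  rw [Real.dimH_univ_eq_finrank, finrank_euclideanSpace_fin]

/-- A set that is neither null nor conull is neither null nor of full measure in some large
cube. -/
lemma exists_isCube_of_volume_pos {A : Set (EuclideanSpace ℝ (Fin n))} (hA : NullMeasurableSet A)
    (hpos : 0 < volume A) (hcpos : 0 < volume Aᶜ) :
    ∃ Q, IsCube Q ∧ 0 < volume (A ∩ Q) ∧ volume (A ∩ Q) < volume Q := by
  set R : ℕ → Set (EuclideanSpace ℝ (Fin n)) := fun N =>
    closedCube (WithLp.toLp 2 fun _ => -((N : ℝ) + 1)) (2 * (N + 1)) with hR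
  have hcube (N : ℕ) : IsCubeAt (WithLp.toLp 2 fun _ => -((N : ℝ) + 1)) (2 * (N + 1)) (R N) :=
    ⟨by positivity, _, fun i => ⟨Set.Ioo_subset_Icc_self, subset_rfl⟩, rfl⟩
  have hmem (N : ℕ) (x : EuclideanSpace ℝ (Fin n)) : x ∈ R N ↔ ∀ i, |x i| ≤ N + 1 := by
    simp only [hR, closedCube, Set.mem_ofPred_eq, abs_le]
    refine forall_congr' fun i => ?_
    constructor <;> rintro ⟨h1, h2⟩ <;> constructor <;> linarith
  have hmono : Monotone R := by
    intro N N' hNN x hx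
    rw [hmem] at *
    have : (N : ℝ) ≤ N' := by exact_mod_cast hNN
    exact fun i => (hx i).trans (by linarith)
  have huniv (x : EuclideanSpace ℝ (Fin n)) : ∃ N, x ∈ R N := by
    obtain ⟨N, hN⟩ := exists_nat_ge (∑ i, |x i|)
    refine ⟨N, (hmem N x).2 fun i => ?_⟩
    have := Finset.single_le_sum (f := fun i => |x i|) (fun i _ => abs_nonneg _) (Finset.mem_univ i)
    simp only at this
    linarith
  have hlarge (E : Set (EuclideanSpace ℝ (Fin n))) (hE : 0 < volume E) :
      ∃ N, 0 < volume (E ∩ R N) := by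
    by_contra! h
    refine hE.ne' (measure_mono_null (t := ⋃ N, E ∩ R N) (fun x hx => ?_)
      (measure_iUnion_null fun N => le_antisymm (h N) zero_le))
    obtain ⟨N, hN⟩ := huniv x
    exact Set.mem_iUnion.2 ⟨N, hx, hN⟩
  obtain ⟨N₁, h₁⟩ := hlarge A hpos
  obtain ⟨N₂, h₂⟩ := hlarge Aᶜ hcpos
  have hA' := h₁.trans_le
    (measure_mono (Set.inter_subset_inter_right A (hmono (le_max_left N₁ N₂))))
  have hAc := h₂.trans_le
    (measure_mono (Set.inter_subset_inter_right Aᶜ (hmono (le_max_right N₁ N₂))))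
  set N := max N₁ N₂
  refine ⟨R N, ⟨_, _, hcube N⟩, hA', ?_⟩
  have hfin : volume (R N) ≠ ⊤ := by
    rw [← volume_preimage_toLp]
    refine ne_top_of_le_ne_top (measure_closedBall_lt_top (x := (0 : Fin n → ℝ))
      (r := (N : ℝ) + 1)).ne (measure_mono fun x hx => ?_)
    rw [mem_closedBall_zero_iff, pi_norm_le_iff_of_nonneg (by positivity)]
    exact (hmem N _).1 hx
  rw [← measure_inter_add_sdiff₀ (R N) hA, Set.inter_comm (R N) A, Set.sdiff_eq,
    Set.inter_comm (R N)]
  exact ENNReal.lt_add_right (ne_top_of_le_ne_top hfin (measure_mono Set.inter_subset_right))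
    hAc.ne'

end SmoothSet

end

theorem theorem1 (n : ℕ) (A : Set (EuclideanSpace ℝ (Fin n))) (hA : SmoothSet.IsSmooth A)
    (hpos : 0 < volume A) (hcpos : 0 < volume Aᶜ) (α : ℝ) (hα0 : 0 < α) (hα1 : α < 1) :
    dimH (SmoothSet.densitySet A α) = (n : ENNReal) ∧
      ∀ Q : Set (EuclideanSpace ℝ (Fin n)), SmoothSet.IsCube Q →
        0 < volume (A ∩ Q) → volume (A ∩ Q) < volume Q →
          dimH (SmoothSet.densitySet A α ∩ Q) = (n : ENNReal) ∧
          dimH (frontier A ∩ Q) = (n : ENNReal) := by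
  refine ⟨le_antisymm (SmoothSet.dimH_le_natCast _) ?_, fun Q hQ h1 h2 => ⟨le_antisymm (SmoothSet.dimH_le_natCast _) ?_,
    le_antisymm (SmoothSet.dimH_le_natCast _) ?_⟩⟩
  · obtain ⟨Q, hQ, h1, h2⟩ := SmoothSet.exists_isCube_of_volume_pos hA.1 hpos hcpos
    exact (hA.le_dimH_densitySet_inter hQ h1 h2 hα0 hα1).trans (dimH_mono Set.inter_subset_left)
  · exact hA.le_dimH_densitySet_inter hQ h1 h2 hα0 hα1
  · exact (hA.le_dimH_densitySet_inter hQ h1 h2 hα0 hα1).trans (dimH_mono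
      (Set.inter_subset_inter_left _ (SmoothSet.densitySet_subset_frontier A hα0.ne' hα1.ne)))
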